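/- Let $p$ be a prime, $q=p^e$, $K=\mathbb{F}_q$, $n\ge 2$, $L=\mathbb{F}_{q^n}$, and let $\sigma$ be a generator of $\mathrm{Gal}(L/K)$, with $x^\sigma=x^{p^j}$. Let $\rho$ be the automorphism $x^\rho=x^{p^i}$ of $L$. Let $R=L[x;\sigma]$ be the skew polynomial ring (with $xa=a^\sigma x$ for $a\in L$), let $F\in K[y]$ be monic and irreducible of degree $s>1$ with constant coefficient $F_0$, and let $E_F=K[y]/(F)\cong\mathbb{F}_{q^s}$ and $R_F=R/RF(x^n)$. For $\eta\in L$ put $$S_{n,s,1}(\eta,\rho,F)=\{a+RF(x^n): \deg a\le s,\ a_s=\eta a_0^{\rho}\}\subseteq R_F ,$$ and let $S_{n,s,1}(0,0,F)$ be the set obtained by requiring $a_s=0$ instead. A *spread set* in $M_n(E_F)$ is an additive subgroup with $|E_F|^n$ elements in which every nonzero element is invertible. It defines a presemifield on $V=E_F^n$ by $a\circ b=\varphi(a)(b)$, where $\varphi$ is any additive bijection from $V$ onto the spread set; the semifields isotopic to it are called the semifields of the spread set. The nuclear parameters of a finite semifield $\mathbb{S}$ are $(|\mathbb{S}|,|\mathbb{N}_l|,|\mathbb{N}_m|,|\mathbb{N}_r|,|Z|)$: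 its order and the orders of its left, middle and right nucleus and of its centre. Write $(a,b,\dots)$ for the greatest common divisor in the exponents below. Then $R_F\cong M_n(E_F)$ as rings, and for every identification of these two rings the following hold. 1. If $K'\le K$ is a subfield fixed elementwise by $\rho$ and $N_{L:K'}(\eta)\,N_{K:K'}\big((-1)^{s(n-1)}F_0\big)\ne 1$, then $S_{n,s,1}(\eta,\rho,F)$ is a spread set. 2. If $\eta\neq 0$ and $S_{n,s,1}(\eta,\rho,F)$ is a spread set, then it has semifields, and every one of them has nuclear parameters $$\big(p^{nse},\,p^{(ne,i)},\,p^{(ne,sj-i)},\,p^{s(ne,j)},\,p^{(ne,i,j)}\big).$$ 3. $S_{n,s,1}(0,0,F)$ is a spread set; it has semifields, and every one of them has nuclear parameters $$\big(p^{nse},\,p^{ne},\,p^{ne},\,p^{se},\,p^{e}\big).$$ -/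

import Mathlib

open Polynomial

namespace SkewSemifield

noncomputable section

universe u v

/-! ### Skew polynomial rings and the codes `S_{n,s,k}(η,ρ,F)` -/

section SkewPolynomials

variable {K : Type u} {L : Type v} [Field K] [Field L] [Algebra K L]

/-- The action of `(ℕ, +)` on `L` by powers of `σ`. -/
abbrev twistAction (σ : L ≃ₐ[K] L) : MulSemiringAction (Multiplicative ℕ) L :=
  MulSemiringAction.compHom L (powersHom (L ≃ₐ[K] L) σ)

/-- The skew polynomial ring `L[x;σ]`, with `x * a = σ a * x` for `a ∈ L`. -/
def SkewPoly (_σ : L ≃ₐ[K] L) : Type v := SkewPolynomial L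

instance (σ : L ≃ₐ[K] L) : Ring (SkewPoly σ) :=
  letI := twistAction σ
  inferInstanceAs (Ring (SkewPolynomial L))

/-- The monomial `a * x ^ m` of `L[x;σ]`. -/
def SkewPoly.monomial (σ : L ≃ₐ[K] L) (m : ℕ) (a : L) : SkewPoly σ :=
  SkewPolynomial.monomial m a

/-- The coefficient of `x ^ m` (coefficients are written on the left). -/
def SkewPoly.coeff {σ : L ≃ₐ[K] L} (a : SkewPoly σ) (m : ℕ) : L :=
  SkewPolynomial.coeff (R := L) a m

/-- The defining commutation rule `(a x^l) (b x^m) = a σ^l(b) x^(l+m)`. -/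
theorem SkewPoly.monomial_mul_monomial (σ : L ≃ₐ[K] L) (l m : ℕ) (a b : L) :
    SkewPoly.monomial σ l a * SkewPoly.monomial σ m b =
      SkewPoly.monomial σ (l + m) (a * (σ ^ l) b) := by
  let _ := twistAction σ
  exact SkewMonoidAlgebra.single_mul_single

/-- The skew polynomial `F(x^n)`, for `F ∈ K[y]`. -/
def evalXPow (σ : L ≃ₐ[K] L) (n : ℕ) (F : K[X]) : SkewPoly σ :=
  F.sum fun m c => SkewPoly.monomial σ (n * m) (algebraMap K L c)

/-- The two-sided ideal of `L[x;σ]` generated by `F(x^n)`. When `σ ^ n = 1`, the element `F(x^n)`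
is central and this is the set `R F(x^n)` of its left multiples. -/
def idealOf (σ : L ≃ₐ[K] L) (n : ℕ) (F : K[X]) : TwoSidedIdeal (SkewPoly σ) :=
  TwoSidedIdeal.span {evalXPow σ n F}

/-- The quotient ring `R_F = R / R F(x^n)`, where `R = L[x;σ]`. -/
abbrev QuotRing (σ : L ≃ₐ[K] L) (n : ℕ) (F : K[X]) : Type v :=
  (idealOf σ n F).ringCon.Quotient

/-- The set `S_{n,s,k}(η,ρ,F) = {a + R F(x^n) : deg a ≤ k s, a_{ks} = η ρ(a_0)}` in `R_F`,
where `s = deg F`. -/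
def code (σ : L ≃ₐ[K] L) (n : ℕ) (k : ℕ) (η : L) (ρ : L → L) (F : K[X]) :
    Set (QuotRing σ n F) :=
  (fun a : SkewPoly σ => (idealOf σ n F).ringCon.mk' a) ''
    {a | (∀ m, k * F.natDegree < m → a.coeff m = 0) ∧
      a.coeff (k * F.natDegree) = η * ρ (a.coeff 0)}

end SkewPolynomials

/-! ### Semifields, nuclei, spread sets -/

/-- A semifield: a not necessarily associative ring with `1 ≠ 0` in which left and right
multiplication by any nonzero element are bijective. -/
def IsSemifield (S : Type u) [NonAssocRing S] : Prop :=
  Nontrivial S ∧ ∀ a : S, a ≠ 0 →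
    Function.Bijective (fun b : S => a * b) ∧ Function.Bijective (fun b : S => b * a)

section Nuclei

variable (S : Type u) [NonAssocRing S]

/-- The left nucleus. -/
def leftNucleus : Set S := {a | ∀ b c : S, a * (b * c) = (a * b) * c}

/-- The middle nucleus. -/
def middleNucleus : Set S := {b | ∀ a c : S, a * (b * c) = (a * b) * c}

/-- The right nucleus. -/
def rightNucleus : Set S := {c | ∀ a b : S, a * (b * c) = (a * b) * c}

/-- The centre: the elements of all three nuclei that commute with every element. -/
def centre : Set S :=
  {z | z ∈ leftNucleus S ∧ z ∈ middleNucleus S ∧ z ∈ rightNucleus S ∧ ∀ b : S, z * b = b * z}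

/-- The nuclear parameters `(|S|, |N_l|, |N_m|, |N_r|, |Z|)` of a finite semifield. -/
def nuclearParameters : ℕ × ℕ × ℕ × ℕ × ℕ :=
  (Nat.card S, Nat.card (leftNucleus S), Nat.card (middleNucleus S),
    Nat.card (rightNucleus S), Nat.card (centre S))

end Nuclei

section SpreadSets

variable {E : Type u} [CommRing E] {n : ℕ}

/-- A (semifield) spread set in `M_n(E)`, `E` a finite field: an additive subgroup of `M_n(E)`
with as many elements as `E^n`, in which every nonzero element is invertible. -/
structure IsSpreadSet (C : Set (Matrix (Fin n) (Fin n) E)) : Prop where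
  zero_mem : 0 ∈ C
  add_mem : ∀ X ∈ C, ∀ Y ∈ C, X + Y ∈ C
  neg_mem : ∀ X ∈ C, -X ∈ C
  isUnit : ∀ X ∈ C, X ≠ 0 → IsUnit X
  card_eq : Nat.card C = Nat.card (Fin n → E)

/-- `S` is isotopic to the presemifield on `V = E^n` with multiplication `a ∘ b = φ(a)(b)`,
where `φ` is an additive bijection from `V` onto `C`. Here `φ` is the map in the presemifield,
and `α`, `β`, `γ` are the additive bijections that make up the isotopism. -/
def IsIsotopicTo (S : Type u) [NonAssocRing S] (C : Set (Matrix (Fin n) (Fin n) E)) : Prop :=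
  ∃ φ : (Fin n → E) →+ Matrix (Fin n) (Fin n) E, Function.Injective φ ∧ Set.range φ = C ∧
    ∃ α β γ : S ≃+ (Fin n → E), ∀ a b : S, γ (a * b) = (φ (α a)).mulVec (β b)

/-- The semifields with spread set `C` (a class of pairwise isotopic semifields) exist and all
have nuclear parameters `t`. -/
def HasNuclearParameters (C : Set (Matrix (Fin n) (Fin n) E)) (t : ℕ × ℕ × ℕ × ℕ × ℕ) : Prop :=
  (∃ (S : Type u) (_ : NonAssocRing S), IsSemifield S ∧ IsIsotopicTo S C) ∧
    ∀ (S : Type u) [NonAssocRing S], IsSemifield S → IsIsotopicTo S C → nuclearParameters S = t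

end SpreadSets

end

end SkewSemifield

/-!
Coefficient polynomials `p : L[X]` model `R_F` through the evaluation `p ↦ ∑ ι (p_k) t ^ k`,
which is injective in degrees below `n s`. The ring `R_F` is simple with centre `E_F`, so
Wedderburn's theorem and a count of elements give `R_F ≅ M_n(E_F)`.

Suppose that a nonzero element `a` of degree at most `s` kills a vector `v` of `E_F ^ n`, which
has dimension `s` over `L`. Irreducibility of `F` makes `v` a cyclic vector for the semilinear
map `w ↦ x w`, so `a` is a multiple of the relation expressing `x ^ s v` in terms of lower
powers. In this basis `x` acts through a companion matrix, and the twisted power of that matrix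
that represents `x ^ n` has characteristic polynomial `F`. Comparing determinants gives
`N_{L:K}(a_0) = (-1) ^ (s (n - 1)) F_0 N_{L:K}(a_s)`, which the norm condition forbids and which
is impossible when `a_s = 0 ≠ a_0`.

For a spread set `C`, the left and middle nuclei are its left and right idealizers and the
centre consists of the scalars stabilizing `C`. The right nucleus is the centralizer of the
subring generated by the products `u⁻¹ c` with `u, c ∈ C`; this subring is all of `M_n(E_F)`, so
the centralizer is `E_F`. Degree considerations show that the left idealizer consists of
constants, and passing to the opposite ring, where `σ` becomes `σ⁻¹`, gives the right idealizer.
The constants that occur are fixed by powers of Frobenius, and counting them produces the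
greatest common divisors.
-/

namespace SkewSemifield

section PolynomialLemmas

lemma mem_degreeLT_iff_natDegree_lt {R : Type*} [Semiring R] {N : ℕ} (hN : 0 < N) {p : R[X]} :
    p ∈ degreeLT R N ↔ p.natDegree < N := by
  rw [mem_degreeLT]
  by_cases hp : p = 0
  · simp [hp, hN]
  · exact (natDegree_lt_iff_degree_lt hp).symm

lemma natCard_degreeLT (R : Type*) [Semiring R] (N : ℕ) :
    Nat.card (degreeLT R N) = Nat.card R ^ N := by
  rw [Nat.card_congr (degreeLTEquiv R N).toEquiv, Nat.card_fun, Nat.card_fin]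

variable {R Q : Type*} [Semiring R] [Semiring Q]

lemma eval₂_mul_X_pow (f : R →+* Q) (x : Q) (p : R[X]) (k : ℕ) :
    (p * X ^ k).eval₂ f x = p.eval₂ f x * x ^ k := by
  induction k with
  | zero => simp
  | succ k ih => rw [pow_succ, ← mul_assoc, eval₂_mul_X, ih, pow_succ, mul_assoc]

lemma eval₂_C_mul (f : R →+* Q) (x : Q) (a : R) (p : R[X]) :
    (C a * p).eval₂ f x = f a * p.eval₂ f x := by
  induction p using Polynomial.induction_on' with
  | add p q hp hq => rw [mul_add, eval₂_add, hp, hq, eval₂_add, mul_add]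
  | monomial m b => rw [C_mul_monomial, eval₂_monomial, eval₂_monomial, map_mul, mul_assoc]

lemma eval₂_expand {R : Type*} [CommSemiring R] (f : R →+* Q) (x : Q) (n : ℕ) (p : R[X]) :
    (expand R n p).eval₂ f x = p.eval₂ f (x ^ n) := by
  induction p using Polynomial.induction_on' with
  | add p q hp hq => simp only [map_add, eval₂_add, hp, hq]
  | monomial m a => rw [expand_monomial, eval₂_monomial, eval₂_monomial, ← pow_mul, mul_comm m]

variable {K : Type*} (L : Type*) [Field K] [Field L] [Algebra K L]

/-- The coefficient list over `L` of the skew polynomial `F(x^n)`. -/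
noncomputable abbrev expandMap (n : ℕ) (F : K[X]) : L[X] :=
  (expand K n F).map (algebraMap K L)

variable {L}

lemma expandMap_monic {n : ℕ} (hn : 0 < n) {F : K[X]} (hF : F.Monic) : (expandMap L n F).Monic :=
  (hF.expand hn).map _

lemma natDegree_expandMap (n : ℕ) (F : K[X]) :
    (expandMap L n F).natDegree = n * F.natDegree := by
  rw [natDegree_map, natDegree_expand, mul_comm]

lemma coeff_zero_expandMap {n : ℕ} (hn : 0 < n) (F : K[X]) :
    (expandMap L n F).coeff 0 = algebraMap K L (F.coeff 0) := by
  simp [coeff_expand hn]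

lemma eval₂_expandMap {Q : Type*} [Semiring Q] (ι : L →+* Q) (t : Q) (n : ℕ) (F : K[X]) :
    (expandMap L n F).eval₂ ι t = F.eval₂ (ι.comp (algebraMap K L)) (t ^ n) := by
  rw [eval₂_map, eval₂_expand]

end PolynomialLemmas

section SkewPair

variable {K L Q : Type*} [CommRing K] [CommRing L] [Algebra K L] [Ring Q]

/-- The defining relation `x a = σ(a) x` of `L[x;σ]`, for the elements `t` and `ι a` of a ring.
Polynomials `p : L[X]` then serve as coefficient lists of skew polynomials with coefficients on
the left, and `p.eval₂ ι t` is the value at `t` of the skew polynomial with coefficients `p`. -/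
structure IsSkewPair (σ : L ≃ₐ[K] L) (ι : L →+* Q) (t : Q) : Prop where
  mul_apply : ∀ a, t * ι a = ι (σ a) * t

/-- The coefficient list of `p * a`, where `p` is read as a skew polynomial and `a` is a
constant. -/
noncomputable def twist (σ : L ≃ₐ[K] L) (p : L[X]) (a : L) : L[X] :=
  ∑ m ∈ p.support, monomial m (p.coeff m * (σ ^ m) a)

lemma coeff_twist (σ : L ≃ₐ[K] L) (p : L[X]) (a : L) (m : ℕ) :
    (twist σ p a).coeff m = p.coeff m * (σ ^ m) a := by
  simp only [twist, finsetSum_coeff, coeff_monomial]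
  rw [Finset.sum_ite_eq' p.support m]
  split_ifs with h
  · rfl
  · rw [notMem_support_iff.1 h, zero_mul]

lemma natDegree_twist_le (σ : L ≃ₐ[K] L) (p : L[X]) (a : L) :
    (twist σ p a).natDegree ≤ p.natDegree :=
  natDegree_le_iff_coeff_eq_zero.2 fun m hm => by
    rw [coeff_twist, coeff_eq_zero_of_natDegree_lt hm, zero_mul]

namespace IsSkewPair

variable {σ : L ≃ₐ[K] L} {ι : L →+* Q} {t : Q} (h : IsSkewPair σ ι t)
include h

lemma pow_mul_apply (m : ℕ) (a : L) : t ^ m * ι a = ι ((σ ^ m) a) * t ^ m := by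
  induction m generalizing a with
  | zero => simp
  | succ m ih =>
    rw [pow_succ, mul_assoc, h.mul_apply, ← mul_assoc, ih, mul_assoc, pow_succ σ,
      AlgEquiv.mul_apply]

lemma pow_mul_eval₂ (k : ℕ) (p : L[X]) :
    t ^ k * p.eval₂ ι t = (p.map ((σ ^ k : L ≃ₐ[K] L) : L →+* L) * X ^ k).eval₂ ι t := by
  rw [eval₂_mul_X_pow]
  induction p using Polynomial.induction_on' with
  | add p q hp hq => rw [eval₂_add, mul_add, hp, hq, Polynomial.map_add, eval₂_add, add_mul]
  | monomial m b =>
    rw [Polynomial.map_monomial, eval₂_monomial, eval₂_monomial, ← mul_assoc, h.pow_mul_apply,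
      mul_assoc, mul_assoc, ← pow_add, ← pow_add, add_comm]
    rfl

lemma mul_eval₂ (p : L[X]) : t * p.eval₂ ι t = (p.map (σ : L →+* L) * X).eval₂ ι t := by
  simpa only [pow_one] using h.pow_mul_eval₂ 1 p

lemma eval₂_mul_apply (p : L[X]) (a : L) : p.eval₂ ι t * ι a = (twist σ p a).eval₂ ι t := by
  conv_lhs => rw [eval₂_eq_sum, sum_def]
  rw [twist, eval₂_finsetSum, Finset.sum_mul]
  refine Finset.sum_congr rfl fun m _ => ?_
  rw [eval₂_monomial, mul_assoc, h.pow_mul_apply, ← mul_assoc, map_mul]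

lemma commute_algebraMap (c : K) : Commute t (ι (algebraMap K L c)) := by
  rw [commute_iff_eq, h.mul_apply, AlgEquiv.commutes]

lemma commute_pow {n : ℕ} (hσ : σ ^ n = 1) (a : L) : Commute (t ^ n) (ι a) := by
  rw [commute_iff_eq, h.pow_mul_apply, hσ, AlgEquiv.one_apply]

end IsSkewPair

lemma IsSkewPair.map {Q' : Type*} [Ring Q'] {σ : L ≃ₐ[K] L} {ι : L →+* Q} {t : Q}
    (h : IsSkewPair σ ι t) (f : Q →+* Q') : IsSkewPair σ (f.comp ι) (f t) where
  mul_apply a := by simp only [RingHom.comp_apply, ← map_mul, h.mul_apply]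

end SkewPair

namespace SkewPoly

variable {K L : Type*} [Field K] [Field L] [Algebra K L] (σ : L ≃ₐ[K] L)

/-- The embedding of `L` into `L[x;σ]`. -/
noncomputable def const : L →+* SkewPoly σ where
  toFun := monomial σ 0
  map_zero' := SkewPolynomial.monomial_zero_right 0
  map_one' := rfl
  map_add' := SkewPolynomial.monomial_add 0
  map_mul' a b := by simp [monomial_mul_monomial]

/-- The variable `x` of `L[x;σ]`. -/
noncomputable def var : SkewPoly σ := monomial σ 1 1

lemma const_apply (a : L) : const σ a = monomial σ 0 a := rfl

lemma const_mul_var_pow (a : L) (m : ℕ) : const σ a * var σ ^ m = monomial σ m a := by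
  induction m with
  | zero => simp [const_apply]
  | succ m ih => rw [pow_succ, ← mul_assoc, ih, var, monomial_mul_monomial]; simp

lemma isSkewPair : IsSkewPair σ (const σ) (var σ) where
  mul_apply a := by simp [var, const_apply, monomial_mul_monomial]

variable {σ}

lemma coeff_add (a b : SkewPoly σ) (m : ℕ) : (a + b).coeff m = a.coeff m + b.coeff m := by
  change (SkewMonoidAlgebra.coeff (k := L) (a + b)) _ = _
  exact congrArg (fun f => f (Multiplicative.ofAdd m)) (SkewMonoidAlgebra.coeff_add (k := L) a b)

lemma coeff_monomial (l m : ℕ) (a : L) : (monomial σ l a).coeff m = if l = m then a else 0 :=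
  SkewPolynomial.coeff_monomial

lemma coeff_eval₂ (p : L[X]) (m : ℕ) : (p.eval₂ (const σ) (var σ)).coeff m = p.coeff m := by
  induction p using Polynomial.induction_on' with
  | add p q hp hq => rw [eval₂_add, coeff_add, hp, hq, Polynomial.coeff_add]
  | monomial l a =>
    rw [eval₂_monomial, const_mul_var_pow, coeff_monomial, Polynomial.coeff_monomial]

lemma eval₂_injective : Function.Injective (eval₂ (const σ) (var σ)) :=
  fun p q h => Polynomial.ext fun m => by
    rw [← coeff_eval₂ (σ := σ), ← coeff_eval₂ (σ := σ), h]

lemma eval₂_surjective : Function.Surjective (eval₂ (const σ) (var σ)) := fun a => by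
  refine SkewPolynomial.induction (R := L)
    (motive := fun a => ∃ p : L[X], p.eval₂ (const σ) (var σ) = (a : SkewPoly σ))
    a ⟨0, eval₂_zero ..⟩ ?_
  rintro m r q - - ⟨p, rfl⟩
  refine ⟨Polynomial.monomial m r + p, ?_⟩
  rw [eval₂_add, eval₂_monomial, const_mul_var_pow]
  rfl

variable {n : ℕ}

lemma eval₂_expandMap_eq_evalXPow (F : K[X]) :
    (expandMap L n F).eval₂ (const σ) (var σ) = evalXPow σ n F := by
  rw [eval₂_expandMap, eval₂_def, evalXPow]
  congr 1
  ext m c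
  rw [← pow_mul, RingHom.comp_apply, const_mul_var_pow]

lemma eval₂_mul_expandMap (q : L[X]) (F : K[X]) :
    (q * expandMap L n F).eval₂ (const σ) (var σ) =
      q.eval₂ (const σ) (var σ) * evalXPow σ n F := by
  rw [eval₂_mul_noncomm, eval₂_expandMap_eq_evalXPow]
  intro k
  rw [coeff_map]
  exact ((isSkewPair σ).commute_algebraMap _).symm

lemma commute_evalXPow (hσ : σ ^ n = 1) (F : K[X]) (a : SkewPoly σ) :
    Commute (evalXPow σ n F) a := by
  obtain ⟨p, rfl⟩ := eval₂_surjective a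
  rw [eval₂_eq_sum, sum_def]
  refine Commute.sum_right _ _ _ fun m _ => Commute.sum_left _ _ _ fun l _ => ?_
  rw [const_mul_var_pow, commute_iff_eq]
  simp only [monomial_mul_monomial, pow_mul, hσ, one_pow, AlgEquiv.commutes, AlgEquiv.one_apply,
    add_comm m, mul_comm (p.coeff m)]

lemma mem_idealOf (hσ : σ ^ n = 1) {F : K[X]} {a : SkewPoly σ} :
    a ∈ idealOf σ n F ↔ ∃ b, a = b * evalXPow σ n F := by
  constructor
  · intro ha
    rw [idealOf, TwoSidedIdeal.mem_span_iff_mem_addSubgroup_closure] at ha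
    induction ha using AddSubgroup.closure_induction with
    | mem x hx =>
      obtain ⟨y, ⟨b, -, _, rfl, rfl⟩, c, -, rfl⟩ := hx
      exact ⟨b * c, by simp only [mul_assoc, (commute_evalXPow hσ F c).eq]⟩
    | zero => exact ⟨0, by rw [zero_mul]⟩
    | add x y _ _ hx hy =>
      obtain ⟨⟨b, rfl⟩, c, rfl⟩ := hx, hy
      exact ⟨b + c, by rw [add_mul]⟩
    | neg x _ hx =>
      obtain ⟨b, rfl⟩ := hx
      exact ⟨-b, by rw [neg_mul]⟩
  · rintro ⟨b, rfl⟩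
    exact TwoSidedIdeal.mul_mem_left _ _ _ (TwoSidedIdeal.subset_span rfl)

end SkewPoly

section SkewModel

variable {K L : Type*} [Field K] [Field L] [Algebra K L] {Q : Type*} [Ring Q]

/-- `Q` is the quotient `R_F` of the skew polynomial ring `L[x;σ]` by the ideal generated by
`F(x^n)`: `ι` is the embedding of `L` and `t` is the class of `x`. -/
structure IsSkewModel (σ : L ≃ₐ[K] L) (n : ℕ) (F : K[X]) (ι : L →+* Q) (t : Q) : Prop
    extends IsSkewPair σ ι t where
  eval₂_eq_zero_iff : ∀ p : L[X], p.eval₂ ι t = 0 ↔ expandMap L n F ∣ p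
  eval₂_surjective : Function.Surjective (eval₂ ι t)

variable {σ : L ≃ₐ[K] L} {n : ℕ} {F : K[X]}

lemma IsSkewModel.map {ι : L →+* Q} {t : Q} (h : IsSkewModel σ n F ι t)
    {Q' : Type*} [Ring Q'] (Φ : Q ≃+* Q') :
    IsSkewModel σ n F ((Φ : Q →+* Q').comp ι) (Φ t) := by
  have eval₂_map (p : L[X]) : p.eval₂ ((Φ : Q →+* Q').comp ι) (Φ t) = Φ (p.eval₂ ι t) :=
    (hom_eval₂ p ι (Φ : Q →+* Q') t).symm
  refine ⟨h.toIsSkewPair.map (Φ : Q →+* Q'), fun p => ?_, fun q => ?_⟩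
  · rw [eval₂_map, ← h.eval₂_eq_zero_iff, map_eq_zero_iff _ Φ.injective]
  · obtain ⟨p, hp⟩ := h.eval₂_surjective (Φ.symm q)
    exact ⟨p, by rw [eval₂_map, hp, Φ.apply_symm_apply]⟩

/-- The quotient map `L[x;σ] → R_F`. -/
noncomputable abbrev quotMk (σ : L ≃ₐ[K] L) (n : ℕ) (F : K[X]) : SkewPoly σ →+* QuotRing σ n F :=
  (idealOf σ n F).ringCon.mk'

lemma quotMk_eval₂ (p : L[X]) :
    quotMk σ n F (p.eval₂ (SkewPoly.const σ) (SkewPoly.var σ)) =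
      p.eval₂ ((quotMk σ n F).comp (SkewPoly.const σ)) (quotMk σ n F (SkewPoly.var σ)) :=
  hom_eval₂ p (SkewPoly.const σ) (quotMk σ n F) (SkewPoly.var σ)

lemma quotMk_eq_zero_iff {a : SkewPoly σ} : quotMk σ n F a = 0 ↔ a ∈ idealOf σ n F := by
  rw [← TwoSidedIdeal.mem_ker, TwoSidedIdeal.ker_ringCon_mk']

theorem isSkewModel_quotRing (hσ : σ ^ n = 1) (F : K[X]) :
    IsSkewModel σ n F ((quotMk σ n F).comp (SkewPoly.const σ))
      (quotMk σ n F (SkewPoly.var σ)) := by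
  refine ⟨(SkewPoly.isSkewPair σ).map (quotMk σ n F), fun p => ?_, fun q => ?_⟩
  · rw [← quotMk_eval₂, quotMk_eq_zero_iff, SkewPoly.mem_idealOf hσ,
      SkewPoly.eval₂_surjective.exists]
    simp only [← SkewPoly.eval₂_mul_expandMap, SkewPoly.eval₂_injective.eq_iff, dvd_def,
      mul_comm (expandMap L n F)]
  · obtain ⟨a, rfl⟩ := RingCon.mk'_surjective _ q
    obtain ⟨p, rfl⟩ := SkewPoly.eval₂_surjective a
    exact ⟨p, (quotMk_eval₂ p).symm⟩

end SkewModel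

section CyclicSetting

variable {K L : Type*} [Field K] [Field L] [Algebra K L]

/-- The data defining `R_F`: the extension `L/K` has degree `n` and its Galois group is generated
by `σ`, and `F` is a monic irreducible polynomial over `K` other than `y`. -/
structure IsCyclicSetting (σ : L ≃ₐ[K] L) (n : ℕ) (F : K[X]) : Prop where
  mem_zpowers : ∀ τ : L ≃ₐ[K] L, τ ∈ Subgroup.zpowers σ
  finrank_eq : Module.finrank K L = n
  monic : F.Monic
  irreducible : Irreducible F
  coeff_zero_ne_zero : F.coeff 0 ≠ 0

namespace IsCyclicSetting

variable {σ : L ≃ₐ[K] L} {n : ℕ} {F : K[X]} (hS : IsCyclicSetting σ n F)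
include hS

lemma natDegree_pos : 0 < F.natDegree := hS.irreducible.natDegree_pos

lemma not_dvd_X : ¬ F ∣ X := fun h =>
  hS.coeff_zero_ne_zero (X_dvd_iff.1 (hS.irreducible.dvd_symm irreducible_X h))

variable [FiniteDimensional K L]

lemma pos : 0 < n := hS.finrank_eq ▸ Module.finrank_pos

lemma mul_natDegree_pos : 0 < n * F.natDegree := Nat.mul_pos hS.pos hS.natDegree_pos

lemma natCard_eq_pow : Nat.card L = Nat.card K ^ n := by
  rw [← hS.finrank_eq]
  exact Module.natCard_eq_pow_finrank

variable [IsGalois K L]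

lemma orderOf_eq : orderOf σ = n := by
  rw [orderOf_eq_card_of_forall_mem_zpowers hS.mem_zpowers, IsGalois.card_aut_eq_finrank,
    hS.finrank_eq]

lemma pow_eq_one : σ ^ n = 1 := hS.orderOf_eq ▸ pow_orderOf_eq_one σ

lemma mem_range_algebraMap {a : L} (ha : σ a = a) : a ∈ Set.range (algebraMap K L) := by
  refine (IsGalois.mem_range_algebraMap_iff_fixed a).2 fun τ => ?_
  have zpowers_le : Subgroup.zpowers σ ≤ MulAction.stabilizer (L ≃ₐ[K] L) a :=
    (Subgroup.zpowers_le).2 ha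
  exact zpowers_le (hS.mem_zpowers τ)

end IsCyclicSetting

lemma exists_expandMap_eq {n : ℕ} (hn : 0 < n) {p : L[X]} (hdvd : ∀ m, p.coeff m ≠ 0 → n ∣ m)
    (hK : ∀ m, p.coeff m ∈ Set.range (algebraMap K L)) : ∃ f : K[X], expandMap L n f = p := by
  obtain ⟨q, rfl⟩ := (mem_lifts p).1 ((lifts_iff_coeff_lifts p).2 hK)
  refine ⟨contract n q, congrArg (map (algebraMap K L)) (Polynomial.ext fun m => ?_)⟩
  rw [coeff_expand hn]
  split_ifs with hm
  · rw [coeff_contract hn.ne', Nat.div_mul_cancel hm]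
  · by_contra hne
    exact hm (hdvd m (by rw [coeff_map]; exact (_root_.map_ne_zero _).2 (Ne.symm hne)))

end CyclicSetting

namespace IsSkewModel

variable {K L : Type*} [Field K] [Field L] [Algebra K L] {Q : Type*} [Ring Q]
  {σ : L ≃ₐ[K] L} {n : ℕ} {F : K[X]} {ι : L →+* Q} {t : Q} (h : IsSkewModel σ n F ι t)
include h

section Values

lemma eq_of_natDegree_lt {p q : L[X]} (hp : p.natDegree < n * F.natDegree)
    (hq : q.natDegree < n * F.natDegree) (hpq : p.eval₂ ι t = q.eval₂ ι t) : p = q := by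
  have hdvd : expandMap L n F ∣ p - q := by
    rw [← h.eval₂_eq_zero_iff, eval₂_sub, hpq, sub_self]
  refine sub_eq_zero.1 (eq_zero_of_dvd_of_natDegree_lt hdvd ?_)
  rw [natDegree_expandMap]
  exact (natDegree_sub_le p q).trans_lt (max_lt hp hq)

lemma exists_natDegree_lt (hN : 0 < n * F.natDegree) (hF : F.Monic) (q : Q) :
    ∃ p : L[X], p.natDegree < n * F.natDegree ∧ p.eval₂ ι t = q := by
  obtain ⟨p, rfl⟩ := h.eval₂_surjective q
  rw [← natDegree_expandMap (L := L)] at hN ⊢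
  refine ⟨p %ₘ expandMap L n F, natDegree_modByMonic_lt _
    (expandMap_monic (Nat.pos_of_ne_zero ?_) hF) fun h1 => ?_, ?_⟩
  · rintro rfl
    simp at hN
  · rw [h1, natDegree_one] at hN
    exact hN.false
  · rw [← sub_eq_zero, ← eval₂_sub, h.eval₂_eq_zero_iff, modByMonic_eq_sub_mul_div]
    exact ⟨-(p /ₘ expandMap L n F), by ring⟩

lemma coeff_zero_of_natDegree_le (hn : 0 < n) (hF : F.Monic) {p : L[X]}
    (hp : p.natDegree ≤ n * F.natDegree) (h0 : p.eval₂ ι t = 0) :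
    p.coeff 0 = p.coeff (n * F.natDegree) * algebraMap K L (F.coeff 0) := by
  obtain ⟨q, rfl⟩ := (h.eval₂_eq_zero_iff p).1 h0
  have hmonic := expandMap_monic (L := L) hn hF
  rcases eq_or_ne q 0 with rfl | hq
  · simp
  obtain ⟨c, rfl⟩ : ∃ c, C c = q := natDegree_eq_zero.1 <| by
    rw [hmonic.natDegree_mul' hq, natDegree_expandMap] at hp
    omega
  rw [coeff_mul_C, coeff_mul_C, coeff_zero_expandMap hn, ← natDegree_expandMap (L := L),
    hmonic.coeff_natDegree, one_mul, mul_comm]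

lemma commute_of_forall {q : Q} (hι : ∀ a, Commute q (ι a)) (ht : Commute q t) (r : Q) :
    Commute q r := by
  obtain ⟨p, rfl⟩ := h.eval₂_surjective r
  rw [eval₂_eq_sum, sum_def]
  exact Commute.sum_right _ _ _ fun m _ => (hι _).mul_right (ht.pow_right m)

lemma injective (hN : 0 < n * F.natDegree) : Function.Injective ι := fun a b hab => by
  have := h.eq_of_natDegree_lt (p := C a) (q := C b) (by rwa [natDegree_C]) (by rwa [natDegree_C])
    (by rw [eval₂_C, eval₂_C, hab])
  exact C_injective this

lemma nontrivial (hN : 0 < n * F.natDegree) : Nontrivial Q := (h.injective hN).nontrivial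

lemma bijective_degreeLT (hN : 0 < n * F.natDegree) (hF : F.Monic) :
    Function.Bijective (fun p : degreeLT L (n * F.natDegree) => p.1.eval₂ ι t) := by
  refine ⟨fun ⟨p, hp⟩ ⟨q, hq⟩ hpq => Subtype.ext ?_, fun q => ?_⟩
  · rw [mem_degreeLT_iff_natDegree_lt hN] at hp hq
    exact h.eq_of_natDegree_lt hp hq hpq
  · obtain ⟨p, hp, rfl⟩ := h.exists_natDegree_lt hN hF q
    exact ⟨⟨p, (mem_degreeLT_iff_natDegree_lt hN).2 hp⟩, rfl⟩

lemma natCard_eq (hN : 0 < n * F.natDegree) (hF : F.Monic) :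
    Nat.card Q = Nat.card L ^ (n * F.natDegree) := by
  rw [← natCard_degreeLT, Nat.card_congr (Equiv.ofBijective _ (h.bijective_degreeLT hN hF))]

lemma finite [Finite L] (hN : 0 < n * F.natDegree) (hF : F.Monic) : Finite Q :=
  have : Finite (degreeLT L (n * F.natDegree)) := Finite.of_equiv _ (degreeLTEquiv L _).toEquiv.symm
  Finite.of_surjective _ (h.bijective_degreeLT hN hF).2

end Values

section CentralValues

lemma commute_eval₂_expandMap (hσ : σ ^ n = 1) (f : K[X]) (r : Q) :
    Commute ((expandMap L n f).eval₂ ι t) r := by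
  rw [eval₂_expandMap, eval₂_eq_sum, sum_def]
  refine Commute.sum_left _ _ _ fun m _ => Commute.mul_left ?_ (Commute.pow_left ?_ m)
  · exact h.commute_of_forall (fun a => (Commute.all _ a).map ι) (h.commute_algebraMap _).symm r
  · exact h.commute_of_forall (h.commute_pow hσ) ((Commute.refl t).pow_left n) r

lemma eval₂_expandMap_mul (f g : K[X]) :
    (expandMap L n (f * g)).eval₂ ι t =
      (expandMap L n f).eval₂ ι t * (expandMap L n g).eval₂ ι t := by
  rw [expandMap, map_mul, Polynomial.map_mul]
  refine eval₂_mul_noncomm ι t fun k => ?_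
  rw [coeff_map]
  exact (h.commute_algebraMap _).symm

lemma eval₂_expandMap_self : (expandMap L n F).eval₂ ι t = 0 :=
  (h.eval₂_eq_zero_iff _).2 dvd_rfl

lemma isUnit_eval₂_expandMap (hσ : σ ^ n = 1) (hF : Irreducible F) {f : K[X]} (hf : ¬ F ∣ f) :
    IsUnit ((expandMap L n f).eval₂ ι t) := by
  obtain ⟨u, v, huv⟩ := hF.coprime_iff_not_dvd.2 hf
  have mul_eq_one : (expandMap L n v).eval₂ ι t * (expandMap L n f).eval₂ ι t = 1 := by
    have := congrArg (fun g => (expandMap L n g).eval₂ ι t) huv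
    simpa only [expandMap, map_add, Polynomial.map_add, eval₂_add, h.eval₂_expandMap_mul,
      h.eval₂_expandMap_self, mul_zero, zero_add, map_one, Polynomial.map_one, eval₂_one] using this
  exact ⟨⟨_, _, by rwa [(h.commute_eval₂_expandMap hσ _ _).eq], mul_eq_one⟩, rfl⟩

lemma eval₂_expandMap_eq_zero_iff [Nontrivial Q] (hσ : σ ^ n = 1) (hF : Irreducible F)
    (f : K[X]) : (expandMap L n f).eval₂ ι t = 0 ↔ F ∣ f := by
  constructor
  · contrapose!
    exact fun hf => (h.isUnit_eval₂_expandMap hσ hF hf).ne_zero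
  · rintro ⟨g, rfl⟩
    rw [h.eval₂_expandMap_mul, h.eval₂_expandMap_self, zero_mul]

end CentralValues

section Centre

variable [FiniteDimensional K L] [IsGalois K L] (hS : IsCyclicSetting σ n F)
include hS

lemma isUnit_var : IsUnit t := by
  have isUnit_pow := h.isUnit_eval₂_expandMap hS.pow_eq_one hS.irreducible hS.not_dvd_X
  rw [eval₂_expandMap, eval₂_X] at isUnit_pow
  exact (isUnit_pow_iff hS.pos.ne').1 isUnit_pow

lemma dvd_of_commute_const {p : L[X]} (hp : p.natDegree < n * F.natDegree)
    (hι : ∀ a, Commute (p.eval₂ ι t) (ι a)) {m : ℕ} (hm : p.coeff m ≠ 0) : n ∣ m := by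
  rw [← hS.orderOf_eq]
  refine orderOf_dvd_of_pow_eq_one (AlgEquiv.ext fun a => ?_)
  have twist_eq : twist σ p a = C a * p :=
    h.eq_of_natDegree_lt ((natDegree_twist_le _ _ _).trans_lt hp)
      ((natDegree_C_mul_le _ _).trans_lt hp) <| by
        rw [← h.eval₂_mul_apply, eval₂_C_mul, (hι a).eq]
  have coeff_eq := congrArg (fun r => coeff r m) twist_eq
  simp only [coeff_twist, coeff_C_mul] at coeff_eq
  exact mul_right_cancel₀ hm (by rw [mul_comm, coeff_eq, AlgEquiv.one_apply])

lemma map_eq_of_commute_var {p : L[X]} (hp : p.natDegree < n * F.natDegree)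
    (ht : Commute (p.eval₂ ι t) t) : p.map (σ : L →+* L) = p := by
  refine h.eq_of_natDegree_lt (natDegree_map_le.trans_lt hp) hp
    ((h.isUnit_var hS).mul_right_cancel ?_)
  rw [ht.eq, h.mul_eval₂, eval₂_mul_X]

lemma exists_eval₂_expandMap_eq {q : Q} (hq : ∀ r, Commute q r) :
    ∃ f : K[X], f.natDegree < F.natDegree ∧ (expandMap L n f).eval₂ ι t = q := by
  obtain ⟨p, hp, rfl⟩ := h.exists_natDegree_lt hS.mul_natDegree_pos hS.monic q
  have map_eq := h.map_eq_of_commute_var hS hp (hq t)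
  have coeff_mem (m) : p.coeff m ∈ Set.range (algebraMap K L) :=
    hS.mem_range_algebraMap (by simpa using congrArg (fun r => coeff r m) map_eq)
  obtain ⟨f, rfl⟩ := exists_expandMap_eq hS.pos
    (fun _ => h.dvd_of_commute_const hS hp fun a => hq (ι a)) coeff_mem
  rw [natDegree_expandMap] at hp
  exact ⟨f, lt_of_mul_lt_mul_left hp n.zero_le, rfl⟩

theorem natCard_center : Nat.card (Subring.center Q) = Nat.card K ^ F.natDegree := by
  have := h.nontrivial hS.mul_natDegree_pos
  let e : degreeLT K F.natDegree → Subring.center Q := fun f =>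
    ⟨(expandMap L n f.1).eval₂ ι t, Subring.mem_center_iff.2 fun r =>
      (h.commute_eval₂_expandMap hS.pow_eq_one f.1 r).eq.symm⟩
  have bijective : Function.Bijective e := by
    refine ⟨fun ⟨f, hf⟩ ⟨g, hg⟩ hfg => Subtype.ext (sub_eq_zero.1 ?_), fun ⟨q, hq⟩ => ?_⟩
    · refine eq_zero_of_dvd_of_natDegree_lt (p := F) ?_
        ((mem_degreeLT_iff_natDegree_lt hS.natDegree_pos).1 (Submodule.sub_mem _ hf hg))
      rw [← h.eval₂_expandMap_eq_zero_iff hS.pow_eq_one hS.irreducible, expandMap, map_sub,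
        Polynomial.map_sub, eval₂_sub, sub_eq_zero]
      exact congrArg Subtype.val hfg
    · obtain ⟨f, hf, rfl⟩ := h.exists_eval₂_expandMap_eq hS
        fun r => (Subring.mem_center_iff.1 hq r).symm
      exact ⟨⟨f, (mem_degreeLT_iff_natDegree_lt hS.natDegree_pos).2 hf⟩, rfl⟩
  rw [← natCard_degreeLT, Nat.card_congr (Equiv.ofBijective e bijective)]

end Centre

section Simplicity

variable [FiniteDimensional K L] (hS : IsCyclicSetting σ n F)
include hS

lemma exists_natDegree_lt_mem {I : TwoSidedIdeal Q} (hI : I ≠ ⊥) :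
    ∃ p : L[X], p ≠ 0 ∧ p.natDegree < n * F.natDegree ∧ p.eval₂ ι t ∈ I := by
  obtain ⟨q, hqI, hq⟩ : ∃ q ∈ I, q ≠ 0 := by
    by_contra! hcon
    exact hI (le_bot_iff.1 fun q hq => (TwoSidedIdeal.mem_bot Q).2 (hcon q hq))
  obtain ⟨p, hp, rfl⟩ := h.exists_natDegree_lt hS.mul_natDegree_pos hS.monic q
  exact ⟨p, fun h0 => hq (by rw [h0, eval₂_zero]), hp, hqI⟩

lemma exists_mem_minimal_support {I : TwoSidedIdeal Q} (hI : I ≠ ⊥) :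
    ∃ (r : L[X]) (d : ℕ), r.coeff d = 1 ∧ r.natDegree < n * F.natDegree ∧ r.eval₂ ι t ∈ I ∧
      ∀ g : L[X], g.natDegree < n * F.natDegree → g.eval₂ ι t ∈ I → g.support ⊆ r.support →
        g = C (g.coeff d) * r := by
  obtain ⟨p, ⟨hp0, hp, hpI⟩, hmin⟩ := (measure fun p : L[X] => p.support.card).wf.has_min
    {p | p ≠ 0 ∧ p.natDegree < n * F.natDegree ∧ p.eval₂ ι t ∈ I} (h.exists_natDegree_lt_mem hS hI)
  have hlc : p.leadingCoeff ≠ 0 := leadingCoeff_ne_zero.2 hp0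
  set r := C p.leadingCoeff⁻¹ * p
  have hrd : r.coeff p.natDegree = 1 := by
    rw [coeff_C_mul, coeff_natDegree, inv_mul_cancel₀ hlc]
  have hrdeg : r.natDegree < n * F.natDegree := (natDegree_C_mul_le _ _).trans_lt hp
  have hrI : r.eval₂ ι t ∈ I := by
    rw [eval₂_C_mul]
    exact I.mul_mem_left _ _ hpI
  have hrp {m : ℕ} (hm : p.coeff m = 0) : r.coeff m = 0 := by rw [coeff_C_mul, hm, mul_zero]
  refine ⟨r, p.natDegree, hrd, hrdeg, hrI, fun g hg hgI hsub => sub_eq_zero.1 ?_⟩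
  by_contra hg0
  refine hmin _ ⟨hg0, ?_, ?_⟩ (Finset.card_lt_card (Finset.ssubset_iff_subset_ne.2 ?_))
  · exact (natDegree_sub_le _ _).trans_lt (max_lt hg ((natDegree_C_mul_le _ _).trans_lt hrdeg))
  · rw [eval₂_sub, eval₂_C_mul]
    exact I.sub_mem hgI (I.mul_mem_left _ _ hrI)
  · refine ⟨fun m => ?_, fun heq => ?_⟩
    · simp only [mem_support_iff, coeff_sub, ne_eq]
      refine mt fun hm => ?_
      rw [coeff_C_mul, hrp hm, mul_zero, sub_zero]
      exact notMem_support_iff.1 fun hmg => mem_support_iff.1 (hsub hmg) (hrp hm)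
    · refine mem_support_iff.1 (heq ▸ natDegree_mem_support_of_nonzero hp0) ?_
      rw [coeff_sub, coeff_C_mul, hrd, mul_one, sub_self]

variable [IsGalois K L]

lemma exists_mem_normalizing {I : TwoSidedIdeal Q} (hI : I ≠ ⊥) :
    ∃ q ∈ I, q ≠ 0 ∧ Commute t q ∧ ∃ d : ℕ, ∀ a, q * ι a = ι ((σ ^ d) a) * q := by
  obtain ⟨r, d, hrd, hr, hrI, hmin⟩ := h.exists_mem_minimal_support hS hI
  have map_eq : r.map (σ : L →+* L) = r := by
    obtain ⟨u, hu⟩ := h.isUnit_var hS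
    have eval₂_map : (r.map (σ : L →+* L)).eval₂ ι t = t * r.eval₂ ι t * ↑u⁻¹ := by
      rw [Units.eq_mul_inv_iff_mul_eq, h.mul_eval₂, eval₂_mul_X, hu]
    have hmap := hmin (r.map (σ : L →+* L)) (natDegree_map_le.trans_lt hr)
      (eval₂_map ▸ I.mul_mem_right _ _ (I.mul_mem_left _ _ hrI)) (support_map_subset _ _)
    rwa [coeff_map, hrd, map_one, C_1, one_mul] at hmap
  have twist_eq (a : L) : twist σ r a = C ((σ ^ d) a) * r := by
    have htwist := hmin (twist σ r a) ((natDegree_twist_le _ _ _).trans_lt hr)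
      (h.eval₂_mul_apply r a ▸ I.mul_mem_right _ _ hrI) fun m => by
        simp only [mem_support_iff, coeff_twist]
        exact left_ne_zero_of_mul
    rwa [coeff_twist, hrd, one_mul] at htwist
  refine ⟨r.eval₂ ι t, hrI, fun h0 => ?_, ?_, d, fun a => ?_⟩
  · have := h.eq_of_natDegree_lt hr (q := 0) (by simpa using hS.mul_natDegree_pos) (by simpa)
    simp [this] at hrd
  · rw [commute_iff_eq, h.mul_eval₂, map_eq, eval₂_mul_X]
  · rw [h.eval₂_mul_apply, twist_eq, eval₂_C_mul]

lemma exists_mem_central {I : TwoSidedIdeal Q} (hI : I ≠ ⊥) :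
    ∃ z ∈ I, z ≠ 0 ∧ ∀ r, Commute z r := by
  obtain ⟨q, hqI, hq0, hqt, d, hqι⟩ := h.exists_mem_normalizing hS hI
  obtain ⟨u, rfl⟩ := h.isUnit_var hS
  refine ⟨q * ↑(u ^ d)⁻¹, I.mul_mem_right _ _ hqI, fun h0 => hq0 ?_, h.commute_of_forall
    (fun a => ?_) (hqt.symm.mul_left ?_)⟩
  · rwa [Units.mul_left_eq_zero] at h0
  · obtain ⟨b, rfl⟩ := (σ ^ d).surjective a
    have inv_mul : ↑(u ^ d)⁻¹ * ι ((σ ^ d) b) = ι b * ↑(u ^ d)⁻¹ := by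
      rw [Units.inv_mul_eq_iff_eq_mul, ← mul_assoc, Units.eq_mul_inv_iff_mul_eq,
        Units.val_pow_eq_pow_val, h.pow_mul_apply]
    rw [commute_iff_eq, mul_assoc, inv_mul, ← mul_assoc, hqι, mul_assoc]
  · rw [Commute.units_val_iff]
    exact ((Commute.refl u).pow_left d).inv_left

theorem isSimpleRing : IsSimpleRing Q := by
  have := h.nontrivial hS.mul_natDegree_pos
  refine ⟨⟨fun I => or_iff_not_imp_left.2 fun hI => I.one_mem_iff.1 ?_⟩⟩
  obtain ⟨z, hzI, hz0, hz⟩ := h.exists_mem_central hS hI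
  obtain ⟨f, -, rfl⟩ := h.exists_eval₂_expandMap_eq hS hz
  obtain ⟨w, hw⟩ := h.isUnit_eval₂_expandMap hS.pow_eq_one hS.irreducible
    (mt (h.eval₂_expandMap_eq_zero_iff hS.pow_eq_one hS.irreducible f).2 hz0)
  simpa only [← hw, Units.inv_mul] using I.mul_mem_left ↑w⁻¹ _ hzI

end Simplicity

end IsSkewModel

section FiniteSimpleRings

lemma natCard_center_matrix {m : ℕ} (hm : m ≠ 0) (R : Type*) [CommRing R] :
    Nat.card (Subring.center (Matrix (Fin m) (Fin m) R)) = Nat.card R := by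
  have : NeZero m := ⟨hm⟩
  rw [Matrix.subringCenter_eq_scalar_map, Subring.center_eq_top]
  exact (Nat.card_image_of_injective (f := Matrix.scalar (Fin m))
    (fun _ _ => Matrix.scalar_inj.1) Set.univ).trans Nat.card_univ

lemma natCard_matrix (m : ℕ) (R : Type*) :
    Nat.card (Matrix (Fin m) (Fin m) R) = Nat.card R ^ (m * m) := by
  rw [Matrix, Nat.card_fun, Nat.card_fun, Nat.card_fin, ← pow_mul]

/- Wedderburn's two theorems give `Q ≃ M_k(D)` with `D` a finite field; the order of the centre
determines `D`, and then the order of `Q` determines `k`. -/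
theorem nonempty_ringEquiv_matrix {Q : Type*} [Ring Q] [Finite Q] [IsSimpleRing Q]
    {E : Type*} [Field E] [Finite E] {m : ℕ} (hZ : Nat.card (Subring.center Q) = Nat.card E)
    (hQ : Nat.card Q = Nat.card E ^ (m * m)) :
    Nonempty (Q ≃+* Matrix (Fin m) (Fin m) E) := by
  obtain ⟨k, hk, D, hD, ⟨e⟩⟩ := IsSimpleRing.exists_ringEquiv_matrix_divisionRing Q
  have : Finite (Matrix (Fin k) (Fin k) D) := Finite.of_equiv Q e.toEquiv
  have : Finite D := Finite.of_injective (Matrix.scalar (Fin k)) fun _ _ => Matrix.scalar_inj.1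
  let _ : Field D := littleWedderburn D
  have hcard : Nat.card D = Nat.card E := by
    rw [← hZ, Nat.card_congr (Subring.centerCongr e).toEquiv, natCard_center_matrix hk.ne]
  obtain rfl : k = m := by
    rw [Nat.card_congr e.toEquiv, natCard_matrix, hcard] at hQ
    exact Nat.mul_self_inj.1 (Nat.pow_right_injective Finite.one_lt_card hQ)
  have := Fintype.ofFinite D
  have := Fintype.ofFinite E
  have f : D ≃+* E := FiniteField.ringEquivOfCardEq (by
    rwa [Fintype.card_eq_nat_card, Fintype.card_eq_nat_card])
  exact ⟨e.trans f.mapMatrix⟩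

end FiniteSimpleRings

section Norm

variable {K L : Type*} [Field K] [Field L] [Algebra K L]

lemma algebraMap_norm_eq_prod_pow [FiniteDimensional K L] [IsGalois K L] {σ : L ≃ₐ[K] L}
    (hσ : ∀ τ : L ≃ₐ[K] L, τ ∈ Subgroup.zpowers σ) (x : L) :
    algebraMap K L (Algebra.norm K x) = ∏ k ∈ Finset.range (orderOf σ), (σ ^ k) x := by
  classical
  rw [Algebra.norm_eq_prod_automorphisms]
  symm
  refine Finset.prod_nbij (σ ^ ·) (fun _ _ => Finset.mem_univ _) ?_ (fun τ _ => ?_)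
    fun _ _ => rfl
  · rw [Finset.coe_range]
    exact pow_injOn_Iio_orderOf
  · simpa using mem_zpowers_iff_mem_range_orderOf.1 (hσ τ)

lemma isUnit_of_aeval_eq_zero {A : Type*} [Ring A] [Algebra K A] {f : K[X]}
    (hf : f.coeff 0 ≠ 0) {x : A} (hx : aeval x f = 0) : IsUnit x := by
  have mul_eq : x * aeval x f.divX = algebraMap K A (-f.coeff 0) := by
    rw [← divX_mul_X_add f, mul_comm, map_add, map_mul, aeval_X, aeval_C] at hx
    rw [map_neg]
    exact eq_neg_of_add_eq_zero_left hx
  have commute : Commute x (aeval x f.divX) := by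
    simpa only [aeval_X] using (Commute.all X f.divX).map (aeval x)
  refine (commute.isUnit_mul_iff.1 ?_).1
  rw [mul_eq]
  exact (neg_ne_zero.2 hf).isUnit.map _

end Norm

section TwistedPower

variable {K L : Type*} [CommRing K] [CommRing L] [Algebra K L] {ι : Type*} [Fintype ι]
  [DecidableEq ι]

/-- The matrix of the `k`-th power of the `σ`-semilinear map with matrix `A`. -/
def twistedPow (σ : L ≃ₐ[K] L) (A : Matrix ι ι L) : ℕ → Matrix ι ι L
  | 0 => 1
  | k + 1 => A * (twistedPow σ A k).map σ

lemma twistedPow_succ' (σ : L ≃ₐ[K] L) (A : Matrix ι ι L) (k : ℕ) :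
    twistedPow σ A (k + 1) = twistedPow σ A k * A.map (σ ^ k : L ≃ₐ[K] L) := by
  induction k with
  | zero =>
    ext
    simp [twistedPow]
  | succ k ih =>
    conv_lhs => rw [twistedPow, ih, Matrix.map_mul, ← mul_assoc, ← twistedPow, Matrix.map_map]
    rw [pow_succ']
    rfl

lemma mul_map_twistedPow {σ : L ≃ₐ[K] L} {n : ℕ} (hσ : σ ^ n = 1) (A : Matrix ι ι L) :
    A * (twistedPow σ A n).map σ = twistedPow σ A n * A := by
  rw [← twistedPow, twistedPow_succ', hσ]
  rfl

lemma det_twistedPow (σ : L ≃ₐ[K] L) (A : Matrix ι ι L) (k : ℕ) :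
    (twistedPow σ A k).det = ∏ l ∈ Finset.range k, (σ ^ l) A.det := by
  induction k with
  | zero => simp [twistedPow]
  | succ k ih =>
    rw [twistedPow_succ', Matrix.det_mul, ih, Finset.prod_range_succ]
    exact congrArg _ (RingHom.map_det ((σ ^ k : L ≃ₐ[K] L) : L →+* L) A).symm

end TwistedPower

section CharacteristicPolynomial

variable {K L : Type*} [Field K] [Field L] [Algebra K L] {ι : Type*} [Fintype ι]
  [DecidableEq ι]

lemma map_charpoly_twistedPow {σ : L ≃ₐ[K] L} {n : ℕ} (hσ : σ ^ n = 1) {A : Matrix ι ι L}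
    (hA : IsUnit A) :
    (twistedPow σ A n).charpoly.map (σ : L →+* L) = (twistedPow σ A n).charpoly := by
  obtain ⟨u, rfl⟩ := hA
  have map_eq : (twistedPow σ (u : Matrix ι ι L) n).map (σ : L →+* L) =
      (u⁻¹).val * (twistedPow σ u n * u.val) := by
    rw [← mul_map_twistedPow hσ, Units.inv_mul_cancel_left]
    rfl
  rw [← Matrix.charpoly_map, map_eq, Matrix.charpoly_mul_comm, Units.mul_inv_cancel_right]

lemma charpoly_eq_of_aeval_eq_zero {F : K[X]} (hF : F.Monic) (hFirr : Irreducible F)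
    {B : Matrix ι ι L} (hι : F.natDegree = Fintype.card ι)
    (hB : ∀ m, B.charpoly.coeff m ∈ Set.range (algebraMap K L)) (hFB : aeval B F = 0) :
    B.charpoly = F.map (algebraMap K L) := by
  have : Nonempty ι := Fintype.card_pos_iff.1 (hι ▸ hFirr.natDegree_pos)
  obtain ⟨P, hP⟩ := (mem_lifts _).1 ((lifts_iff_coeff_lifts _).2 hB)
  have monic : P.Monic := monic_of_injective (algebraMap K L).injective (hP ▸ B.charpoly_monic)
  have natDegree_eq : P.natDegree = F.natDegree := by
    rw [hι, ← B.charpoly_natDegree_eq_dim, ← hP, natDegree_map]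
  have dvd : F ∣ P := by
    rw [minpoly.eq_of_irreducible_of_monic hFirr hFB hF]
    refine minpoly.dvd K B ?_
    rw [← aeval_map_algebraMap L, hP, Matrix.aeval_self_charpoly]
  rw [← hP, eq_of_monic_of_dvd_of_natDegree_le hF monic dvd natDegree_eq.le]

theorem norm_det_of_aeval_twistedPow [FiniteDimensional K L] [IsGalois K L] {σ : L ≃ₐ[K] L}
    {n : ℕ} {F : K[X]} (hS : IsCyclicSetting σ n F) (hι : F.natDegree = Fintype.card ι)
    {A : Matrix ι ι L} (hA : aeval (twistedPow σ A n) F = 0) :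
    Algebra.norm K A.det = (-1) ^ F.natDegree * F.coeff 0 := by
  have det_eq : (twistedPow σ A n).det = algebraMap K L (Algebra.norm K A.det) := by
    rw [algebraMap_norm_eq_prod_pow hS.mem_zpowers, hS.orderOf_eq, det_twistedPow]
  have isUnit : IsUnit A := by
    have := isUnit_of_aeval_eq_zero hS.coeff_zero_ne_zero hA
    rw [Matrix.isUnit_iff_isUnit_det, isUnit_iff_ne_zero] at this ⊢
    contrapose! this
    rw [det_eq, this, Algebra.norm_zero, map_zero]
  have charpoly_eq := charpoly_eq_of_aeval_eq_zero hS.monic hS.irreducible hι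
    (fun m => hS.mem_range_algebraMap (by
      simpa using congrArg (fun P => coeff P m) (map_charpoly_twistedPow hS.pow_eq_one isUnit))) hA
  apply (algebraMap K L).injective
  rw [← det_eq, Matrix.det_eq_sign_charpoly_coeff, charpoly_eq, coeff_map, ← hι, map_mul, map_pow,
    map_neg, map_one]

end CharacteristicPolynomial

lemma det_companion {R : Type*} [CommRing R] (r : ℕ) (a : Fin (r + 1) → R)
    (A : Matrix (Fin (r + 1)) (Fin (r + 1)) R)
    (h1 : ∀ (j : Fin r) i, A i j.castSucc = if i = j.succ then 1 else 0)
    (h2 : ∀ i, A i (Fin.last r) = -a i) : A.det = (-1) ^ (r + 1) * a 0 := by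
  rw [Matrix.det_succ_row_zero, Finset.sum_eq_single (Fin.last r)]
  · have submatrix_eq : A.submatrix Fin.succ (Fin.last r).succAbove = 1 := by
      ext i j
      rw [Matrix.submatrix_apply, Fin.succAbove_last, h1, Matrix.one_apply]
      simp only [Fin.succ_inj]
    rw [submatrix_eq, h2, Matrix.det_one, Fin.val_last]
    ring
  · intro j _ hj
    obtain ⟨k, rfl⟩ := Fin.exists_castSucc_eq.2 hj
    rw [h1, if_neg (Fin.succ_ne_zero k).symm, mul_zero, zero_mul]
  · exact fun hlast => absurd (Finset.mem_univ _) hlast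

section Semilinear

/-- The matrix of the semilinear map `w ↦ t • w` in the basis `b`. -/
noncomputable def smulMatrix {L Q V ι : Type*} [CommSemiring L] [AddCommGroup V] [Module L V]
    [SMul Q V] (b : Module.Basis ι L V) (t : Q) : Matrix ι ι L :=
  b.toMatrix fun j => t • b j

namespace IsSkewPair

variable {K L Q V : Type*} [CommRing K] [CommRing L] [Algebra K L] [Ring Q] [AddCommGroup V]
  [Module Q V] [Module L V] {σ : L ≃ₐ[K] L} {ι : L →+* Q} {t : Q}
  (h : IsSkewPair σ ι t) (hV : ∀ (a : L) (w : V), a • w = ι a • w)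
include h hV

lemma smul_smul_comm (a : L) (w : V) : t • a • w = σ a • t • w := by
  rw [hV, hV, ← mul_smul, h.mul_apply, mul_smul]

section Matrices

variable {β : Type*} [Fintype β] [DecidableEq β] (b : Module.Basis β L V)

omit [DecidableEq β] in
lemma repr_smul (w : V) :
    ⇑(b.repr (t • w)) = (smulMatrix b t).mulVec (fun j => σ (b.repr w j)) := by
  ext i
  conv_lhs => rw [← b.sum_repr w]
  rw [Finset.smul_sum, map_sum, Finsupp.finsetSum_apply, Matrix.mulVec, dotProduct]
  refine Finset.sum_congr rfl fun j _ => ?_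
  rw [h.smul_smul_comm hV, map_smul, Finsupp.smul_apply, smul_eq_mul, mul_comm]
  rfl

lemma repr_pow_smul (k : ℕ) (w : V) :
    ⇑(b.repr (t ^ k • w)) =
      (twistedPow σ (smulMatrix b t) k).mulVec (fun j => (σ ^ k) (b.repr w j)) := by
  induction k generalizing w with
  | zero => simp [twistedPow]
  | succ k ih =>
    rw [pow_succ', mul_smul, h.repr_smul hV, ih, twistedPow, ← Matrix.mulVec_mulVec, pow_succ']
    congr 1
    exact funext fun i => RingHom.map_mulVec (σ : L →+* L) _ _ i

lemma repr_eval₂_pow_smul {n : ℕ} (hσ : σ ^ n = 1) (f : K[X]) (w : V) :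
    ⇑(b.repr (f.eval₂ (ι.comp (algebraMap K L)) (t ^ n) • w)) =
      (aeval (twistedPow σ (smulMatrix b t) n) f).mulVec (b.repr w) := by
  set B := twistedPow σ (smulMatrix b t) n
  have repr_pow_pow_smul (k : ℕ) (w : V) :
      ⇑(b.repr ((t ^ n) ^ k • w)) = (B ^ k).mulVec (b.repr w) := by
    induction k generalizing w with
    | zero => simp
    | succ k ih =>
      rw [pow_succ, mul_smul, ih, h.repr_pow_smul hV, hσ, pow_succ, ← Matrix.mulVec_mulVec]
      rfl
  induction f using Polynomial.induction_on' with
  | add p q hp hq =>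
    rw [eval₂_add, add_smul, map_add, Finsupp.coe_add, hp, hq, map_add, Matrix.add_mulVec]
  | monomial k c =>
    rw [eval₂_monomial, mul_smul, RingHom.comp_apply, ← hV, map_smul, Finsupp.coe_smul,
      repr_pow_pow_smul, aeval_monomial, ← Algebra.smul_def, Matrix.smul_mulVec, algebraMap_smul]

end Matrices

end IsSkewPair

end Semilinear

section CyclicVector

variable {K L Q V : Type*} [Field K] [Field L] [Algebra K L] [Ring Q] [AddCommGroup V]
  [Module Q V] [Module L V] {σ : L ≃ₐ[K] L} {ι : L →+* Q} {t : Q}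
  (hV : ∀ (a : L) (w : V), a • w = ι a • w) {p : L[X]} (hp : p ≠ 0) {v : V}
  (hv : p.eval₂ ι t • v = 0)
include hV hp hv

lemma pow_natDegree_smul :
    t ^ p.natDegree • v =
      ∑ m ∈ Finset.range p.natDegree, (-(p.coeff m / p.leadingCoeff)) • t ^ m • v := by
  have hlc : p.leadingCoeff ≠ 0 := leadingCoeff_ne_zero.2 hp
  rw [eval₂_eq_sum_range, Finset.sum_smul, Finset.sum_range_succ, coeff_natDegree] at hv
  simp only [mul_smul, ← hV] at hv
  rw [← inv_smul_smul₀ hlc (t ^ p.natDegree • v), eq_neg_of_add_eq_zero_right hv,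
    ← Finset.sum_neg_distrib, Finset.smul_sum]
  exact Finset.sum_congr rfl fun m _ => by rw [smul_neg, smul_smul, neg_smul, inv_mul_eq_div]

namespace IsSkewPair

variable (h : IsSkewPair σ ι t)
include h

lemma pow_smul_mem_span (k : ℕ) :
    t ^ k • v ∈ Submodule.span L (Set.range fun m : Fin p.natDegree => t ^ (m : ℕ) • v) := by
  set W := Submodule.span L (Set.range fun m : Fin p.natDegree => t ^ (m : ℕ) • v)
  have mem_of_lt {m : ℕ} (hm : m < p.natDegree) : t ^ m • v ∈ W :=
    Submodule.subset_span ⟨⟨m, hm⟩, rfl⟩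
  have mem_of_le {m : ℕ} (hm : m ≤ p.natDegree) : t ^ m • v ∈ W := by
    rcases hm.lt_or_eq with hm | rfl
    · exact mem_of_lt hm
    · rw [pow_natDegree_smul hV hp hv]
      exact Submodule.sum_mem _ fun m hm => W.smul_mem _ (mem_of_lt (Finset.mem_range.1 hm))
  have smul_mem {w : V} (hw : w ∈ W) : t • w ∈ W := by
    induction hw using Submodule.span_induction with
    | mem w hw =>
      obtain ⟨m, rfl⟩ := hw
      dsimp only
      rw [← mul_smul, ← pow_succ']
      exact mem_of_le m.2
    | zero => rw [smul_zero]; exact W.zero_mem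
    | add x y _ _ hx hy => rw [smul_add]; exact W.add_mem hx hy
    | smul a x _ hx => rw [h.smul_smul_comm hV]; exact W.smul_mem _ hx
  induction k with
  | zero => exact mem_of_le (Nat.zero_le _)
  | succ k ih => rw [pow_succ', mul_smul]; exact smul_mem ih

variable (hspan : ∀ w : V, ∃ q : L[X], q.eval₂ ι t • v = w)
include hspan

lemma span_pow_smul_eq_top :
    Submodule.span L (Set.range fun m : Fin p.natDegree => t ^ (m : ℕ) • v) = ⊤ := by
  refine eq_top_iff.2 fun w _ => ?_
  obtain ⟨q, rfl⟩ := hspan w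
  rw [eval₂_eq_sum, sum_def, Finset.sum_smul]
  refine Submodule.sum_mem _ fun m _ => ?_
  rw [mul_smul, ← hV]
  exact Submodule.smul_mem _ _ (h.pow_smul_mem_span hV hp hv m)

lemma finrank_le_natDegree : Module.finrank L V ≤ p.natDegree := by
  have := finrank_range_le_card (R := L) (fun m : Fin p.natDegree => t ^ (m : ℕ) • v)
  rwa [Set.finrank, h.span_pow_smul_eq_top hV hp hv hspan, finrank_top, Fintype.card_fin] at this

lemma exists_basis_pow_smul {d : ℕ} (hd : p.natDegree = d) (hfin : Module.finrank L V = d) :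
    ∃ b : Module.Basis (Fin d) L V, ∀ m, b m = t ^ (m : ℕ) • v := by
  subst hd
  refine ⟨basisOfTopLeSpanOfCardEqFinrank _ (h.span_pow_smul_eq_top hV hp hv hspan).ge
    (by rw [Fintype.card_fin, hfin]), fun m => ?_⟩
  rw [coe_basisOfTopLeSpanOfCardEqFinrank]

end IsSkewPair

lemma det_smulMatrix {r : ℕ} (hr : p.natDegree = r + 1) {b : Module.Basis (Fin (r + 1)) L V}
    (hb : ∀ m, b m = t ^ (m : ℕ) • v) :
    (smulMatrix b t).det = (-1) ^ (r + 1) * (p.coeff 0 / p.leadingCoeff) := by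
  have smul_basis (m) : t • b m = t ^ (m + 1 : ℕ) • v := by
    rw [hb, ← mul_smul, ← pow_succ']
  refine det_companion r (fun m => p.coeff m / p.leadingCoeff) _ (fun j i => ?_) fun i => ?_
  · have smul_castSucc : t • b j.castSucc = b j.succ := by rw [smul_basis, hb]; rfl
    rw [smulMatrix, Module.Basis.toMatrix_apply, smul_castSucc, b.repr_self, Finsupp.single_apply]
    simp only [eq_comm]
  · have smul_last : t • b (Fin.last r) =
        ∑ m : Fin (r + 1), (-(p.coeff m / p.leadingCoeff)) • b m := by
      simp only [hb]
      rw [← hb, smul_basis, Fin.val_last, ← hr, pow_natDegree_smul hV hp hv, hr,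
        Finset.sum_range fun m => (-(p.coeff m / p.leadingCoeff)) • t ^ m • v]
    rw [smulMatrix, Module.Basis.toMatrix_apply, smul_last, b.repr_sum_self]

/- The matrix of `t` in the basis `v, t • v, …, t ^ (s - 1) • v` is a companion matrix, and the
`n`-th power of this semilinear map has characteristic polynomial `F`. -/
theorem IsSkewModel.norm_coeff_zero_of_smul_eq_zero [FiniteDimensional K L] [IsGalois K L]
    {n : ℕ} {F : K[X]} (h : IsSkewModel σ n F ι t) (hS : IsCyclicSetting σ n F)
    (hspan : ∀ w : V, ∃ q : L[X], q.eval₂ ι t • v = w)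
    (hfin : Module.finrank L V = F.natDegree) (hd : p.natDegree = F.natDegree) :
    Algebra.norm K (p.coeff 0) =
      (-1) ^ (F.natDegree * (n - 1)) * F.coeff 0 * Algebra.norm K p.leadingCoeff := by
  obtain ⟨r, hr⟩ := Nat.exists_eq_add_one.2 hS.natDegree_pos
  obtain ⟨k, hk⟩ := Nat.exists_eq_add_one.2 hS.pos
  obtain ⟨b, hb⟩ := h.exists_basis_pow_smul hV hp hv hspan (hd.trans hr) (hfin.trans hr)
  have norm_det : Algebra.norm K (smulMatrix b t).det = (-1) ^ F.natDegree * F.coeff 0 := by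
    refine norm_det_of_aeval_twistedPow hS (by rw [Fintype.card_fin, hr]) ?_
    refine Matrix.ext_of_mulVec_single fun i => ?_
    rw [← Finsupp.single_eq_pi_single, ← b.repr_self, ← h.repr_eval₂_pow_smul hV b hS.pow_eq_one,
      ← eval₂_expandMap, h.eval₂_expandMap_self, zero_smul, map_zero, Finsupp.coe_zero,
      Matrix.zero_mulVec]
  have norm_neg_one : Algebra.norm K (-1 : L) = (-1) ^ n := by
    simpa only [map_neg (algebraMap K L), map_one, hS.finrank_eq] using
      Algebra.norm_algebraMap (S := L) (-1 : K)
  have sign : (-1) ^ (F.natDegree * (n - 1)) * (-1) ^ (n * F.natDegree) =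
      ((-1) ^ F.natDegree : K) := by
    rw [hk, Nat.add_sub_cancel, add_mul, one_mul, pow_add, mul_comm k, ← mul_assoc, ← mul_pow,
      neg_one_mul, neg_neg, one_pow, one_mul]
  have leadingCoeff_mul : p.leadingCoeff * (smulMatrix b t).det =
      (-1) ^ F.natDegree * p.coeff 0 := by
    rw [det_smulMatrix hV hp hv (hd.trans hr) hb, ← hr, mul_left_comm,
      mul_div_cancel₀ _ (leadingCoeff_ne_zero.2 hp)]
  have norm_eq := congrArg (Algebra.norm K) leadingCoeff_mul
  rw [map_mul, map_mul, map_pow, norm_neg_one, norm_det, ← pow_mul, ← sign] at norm_eq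
  refine mul_left_cancel₀ (pow_ne_zero (n * F.natDegree) (neg_ne_zero.2 one_ne_zero)) ?_
  rw [← norm_eq]
  ring

end CyclicVector

section CodeSetting

variable {K L : Type*} [Field K] [Field L] [Algebra K L]

/-- The data of the codes `S_{n,s,1}(η,ρ,F)`, where `s` is the degree of `F`: a cyclic setting with
`n ≥ 2` and `s > 1`. -/
structure IsCodeSetting (σ : L ≃ₐ[K] L) (n : ℕ) (F : K[X]) : Prop
    extends IsCyclicSetting σ n F where
  two_le : 2 ≤ n
  one_lt : 1 < F.natDegree

lemma coeff_zero_ne_zero_of_irreducible {F : K[X]} (hF : Irreducible F) (hs : 1 < F.natDegree) :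
    F.coeff 0 ≠ 0 := fun h0 => by
  have associated_X := (irreducible_X.dvd_irreducible_iff_associated hF).1 (X_dvd_iff.2 h0)
  have natDegree_eq :=
    natDegree_eq_of_degree_eq (degree_eq_degree_of_associated associated_X)
  rw [natDegree_X] at natDegree_eq
  exact hs.ne natDegree_eq

namespace IsCodeSetting

variable {σ : L ≃ₐ[K] L} {n : ℕ} {F : K[X]} (hS : IsCodeSetting σ n F)
include hS

lemma two_mul_natDegree_le : 2 * F.natDegree ≤ n * F.natDegree :=
  Nat.mul_le_mul_right _ hS.two_le

lemma natDegree_lt : F.natDegree < n * F.natDegree := by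
  have := hS.two_mul_natDegree_le
  have := hS.one_lt
  omega

end IsCodeSetting

end CodeSetting

section CodePoly

variable {L : Type*} [Field L]

/-- The coefficient lists of the skew polynomials `a` with `deg a ≤ s` and `a_s = φ(a_0)`. -/
def codePoly (s : ℕ) (φ : L →+ L) : AddSubgroup L[X] where
  carrier := {p | p.natDegree ≤ s ∧ p.coeff s = φ (p.coeff 0)}
  zero_mem' := by simp
  add_mem' hp hq := ⟨(natDegree_add_le _ _).trans (max_le hp.1 hq.1), by
    rw [coeff_add, coeff_add, map_add, hp.2, hq.2]⟩
  neg_mem' hp := ⟨(natDegree_neg _).trans_le hp.1, by rw [coeff_neg, coeff_neg, map_neg, hp.2]⟩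

variable {s : ℕ} {φ : L →+ L} {p : L[X]}

lemma mem_codePoly_of_natDegree_lt (hp : p.natDegree < s) (h0 : p.coeff 0 = 0) :
    p ∈ codePoly s φ :=
  ⟨hp.le, by rw [h0, map_zero, coeff_eq_zero_of_natDegree_lt hp]⟩

lemma C_add_mem_codePoly (hs : 0 < s) (a : L) : C a + C (φ a) * X ^ s ∈ codePoly s φ :=
  ⟨(natDegree_add_le _ _).trans
    (max_le ((natDegree_C a).trans_le s.zero_le) (natDegree_C_mul_X_pow_le _ _)), by
    simp [coeff_C, coeff_X_pow, hs.ne, hs.ne']⟩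

lemma natDegree_lt_of_coeff_eq_zero (hs : 0 < s) (hp : p.natDegree ≤ s) (h : p.coeff s = 0) :
    p.natDegree < s := by
  refine lt_of_le_of_ne hp fun hd => ?_
  rw [← hd, coeff_natDegree, leadingCoeff_eq_zero] at h
  rw [h, natDegree_zero] at hd
  exact hs.ne hd

lemma natDegree_lt_of_mem_codePoly (hs : 0 < s) (hp : p ∈ codePoly s φ) (h0 : p.coeff 0 = 0) :
    p.natDegree < s :=
  natDegree_lt_of_coeff_eq_zero hs hp.1 (by rw [hp.2, h0, map_zero])

lemma image_degreeLT_eq_codePoly (hs : 0 < s) (φ : L →+ L) :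
    (fun p => p + C (φ (p.coeff 0)) * X ^ s) '' (degreeLT L s : Set L[X]) = codePoly s φ := by
  ext q
  simp only [Set.mem_image, SetLike.mem_coe, mem_degreeLT_iff_natDegree_lt hs]
  constructor
  · rintro ⟨p, hp, rfl⟩
    refine ⟨(natDegree_add_le _ _).trans (max_le hp.le (natDegree_C_mul_X_pow_le _ _)), ?_⟩
    simp [coeff_X_pow, hs.ne, coeff_eq_zero_of_natDegree_lt hp]
  · intro hq
    refine ⟨q - C (φ (q.coeff 0)) * X ^ s, natDegree_lt_of_coeff_eq_zero hs ?_ ?_, ?_⟩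
    · exact (natDegree_sub_le _ _).trans (max_le hq.1 (natDegree_C_mul_X_pow_le _ _))
    · simp [hq.2]
    · simp [coeff_X_pow, hs.ne]

lemma natCard_codePoly (hs : 0 < s) (φ : L →+ L) :
    Nat.card (codePoly s φ) = Nat.card L ^ s := by
  rw [← natCard_degreeLT, ← SetLike.coe_sort_coe, ← image_degreeLT_eq_codePoly hs]
  refine Nat.card_image_of_injOn fun p _ q _ hpq => ?_
  have coeff_eq := congrArg (coeff · 0) hpq
  simp only [coeff_add, coeff_C_mul_X_pow, if_neg hs.ne, add_zero] at coeff_eq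
  simpa only [coeff_eq, add_left_inj] using hpq

end CodePoly

section SkewCode

variable {L : Type*} [Field L] {Q : Type*} [Ring Q]

/-- The set of the classes of the skew polynomials `a` with `deg a ≤ s` and `a_s = φ(a_0)`, in a
quotient of `L[x;σ]` given by the images `ι` of `L` and `t` of `x`. The code `S_{n,s,1}(η,ρ,F)` is
the case of the map `φ(a) = η ρ(a)`. -/
noncomputable def skewCode (ι : L →+* Q) (t : Q) (s : ℕ) (φ : L →+ L) : AddSubgroup Q :=
  (codePoly s φ).map (eval₂AddMonoidHom ι t)

variable {ι : L →+* Q} {t : Q} {s : ℕ} {φ : L →+ L}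

lemma eval₂_mem_skewCode {p : L[X]} (hp : p ∈ codePoly s φ) : p.eval₂ ι t ∈ skewCode ι t s φ :=
  ⟨p, hp, rfl⟩

lemma const_mul_pow_mem_skewCode {k : ℕ} (hk : 0 < k) (hks : k < s) (a : L) :
    ι a * t ^ k ∈ skewCode ι t s φ := by
  rw [← eval₂_monomial]
  exact eval₂_mem_skewCode (mem_codePoly_of_natDegree_lt
    ((natDegree_monomial_le _).trans_lt hks) (by rw [coeff_monomial, if_neg hk.ne']))

lemma var_mem_skewCode (hs : 1 < s) : t ∈ skewCode ι t s φ := by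
  simpa using const_mul_pow_mem_skewCode (ι := ι) (t := t) (φ := φ) one_pos hs 1

lemma const_add_mem_skewCode (hs : 0 < s) (a : L) :
    ι a + ι (φ a) * t ^ s ∈ skewCode ι t s φ := by
  simpa only [eval₂_add, eval₂_C, eval₂_C_mul, eval₂_X_pow] using
    eval₂_mem_skewCode (ι := ι) (t := t) (C_add_mem_codePoly (φ := φ) hs a)

variable {K : Type*} [Field K] [Algebra K L] {σ : L ≃ₐ[K] L} {n : ℕ} {F : K[X]}

namespace IsSkewModel

variable (h : IsSkewModel σ n F ι t)
include h

lemma eval₂_mem_skewCode_iff (hs : s < n * F.natDegree) {p : L[X]}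
    (hp : p.natDegree < n * F.natDegree) :
    p.eval₂ ι t ∈ skewCode ι t s φ ↔ p ∈ codePoly s φ := by
  refine ⟨?_, eval₂_mem_skewCode⟩
  rintro ⟨q, hq, hqp⟩
  rwa [← h.eq_of_natDegree_lt (hq.1.trans_lt hs) hp hqp]

lemma natCard_skewCode (hs : 0 < s) (hsN : s < n * F.natDegree) (φ : L →+ L) :
    Nat.card (skewCode ι t s φ) = Nat.card L ^ s := by
  rw [← natCard_codePoly hs φ]
  exact Nat.card_image_of_injOn fun p hp q hq hpq =>
    h.eq_of_natDegree_lt (hp.1.trans_lt hsN) (hq.1.trans_lt hsN) hpq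

end IsSkewModel

lemma image_code {η : L} {ρ : L → L} (hφ : ∀ a, φ a = η * ρ a) (Φ : QuotRing σ n F ≃+* Q) :
    Φ '' code σ n 1 η ρ F =
      skewCode ((Φ : QuotRing σ n F →+* Q).comp ((quotMk σ n F).comp (SkewPoly.const σ)))
        (Φ (quotMk σ n F (SkewPoly.var σ))) F.natDegree φ := by
  have coe_eq_image : code σ n 1 η ρ F =
      (fun p => quotMk σ n F (p.eval₂ (SkewPoly.const σ) (SkewPoly.var σ))) ''
        (codePoly F.natDegree φ : Set L[X]) := by
    rw [code, ← SkewPoly.eval₂_surjective.image_preimage {a | _}, Set.image_image]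
    congr 1
    ext p
    simp only [one_mul, Set.mem_preimage, Set.mem_ofPred_eq, SkewPoly.coeff_eval₂, ← hφ,
      ← natDegree_le_iff_coeff_eq_zero]
    rfl
  rw [coe_eq_image, Set.image_image]
  refine Set.image_congr fun p _ => ?_
  rw [quotMk_eval₂]
  exact hom_eval₂ p _ (Φ : QuotRing σ n F →+* Q) _

end SkewCode

section SpreadSet

lemma exists_mulVec_eq {E m : Type*} [Field E] [Fintype m] {v : m → E}
    (hv : v ≠ 0) (w : m → E) : ∃ A : Matrix m m E, A.mulVec v = w := by
  classical
  obtain ⟨i, hi⟩ := Function.ne_iff.1 hv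
  refine ⟨Matrix.vecMulVec w (Pi.single i (v i)⁻¹), ?_⟩
  rw [Matrix.vecMulVec_mulVec, single_dotProduct, inv_mul_cancel₀ hi, MulOpposite.op_one, one_smul]

variable {K L : Type*} [Field K] [Field L] [Finite L] [Algebra K L] {E : Type*} [Field E]
  {σ : L ≃ₐ[K] L} {n : ℕ} {F : K[X]} {ι : L →+* Matrix (Fin n) (Fin n) E}
  {t : Matrix (Fin n) (Fin n) E} (hS : IsCodeSetting σ n F) (h : IsSkewModel σ n F ι t)
  (hE : Nat.card E = Nat.card K ^ F.natDegree) {φ : L →+ L}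
include hS h hE

/- A kernel vector `v` of `p(t)` turns `E ^ n` into a cyclic module generated by a vector killed
by `p(t)`. -/
lemma norm_coeff_zero_of_not_isUnit {p : L[X]} (hp : p ≠ 0) (hd : p.natDegree ≤ F.natDegree)
    (hu : ¬ IsUnit (p.eval₂ ι t)) :
    p.natDegree = F.natDegree ∧ Algebra.norm K (p.coeff 0) =
      (-1) ^ (F.natDegree * (n - 1)) * F.coeff 0 * Algebra.norm K p.leadingCoeff := by
  rw [Matrix.isUnit_iff_isUnit_det, isUnit_iff_ne_zero, not_not,
    ← Matrix.exists_mulVec_eq_zero_iff] at hu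
  obtain ⟨v, hv0, hv⟩ := hu
  let _ : Module (Matrix (Fin n) (Fin n) E) (Fin n → E) :=
    Module.compHom _ (Matrix.toLinAlgEquiv' (R := E) (n := Fin n)).toRingEquiv.toRingHom
  let _ : Module L (Fin n → E) := Module.compHom _ ι
  have const_smul (a : L) (w : Fin n → E) : a • w = ι a • w := rfl
  have spans (w : Fin n → E) : ∃ q : L[X], q.eval₂ ι t • v = w := by
    obtain ⟨A, hA⟩ := exists_mulVec_eq hv0 w
    obtain ⟨q, rfl⟩ := h.eval₂_surjective A
    exact ⟨q, hA⟩
  have finrank_eq : Module.finrank L (Fin n → E) = F.natDegree := by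
    have : Finite E := Nat.finite_of_card_ne_zero (hE ▸ pow_ne_zero _ (by
      have := Finite.of_injective _ (algebraMap K L).injective
      exact Nat.card_pos.ne'))
    refine Nat.pow_right_injective (Finite.one_lt_card (α := L)) ?_
    dsimp only
    rw [← Module.natCard_eq_pow_finrank, Nat.card_fun, Nat.card_fin, hE, hS.natCard_eq_pow,
      ← pow_mul, ← pow_mul, mul_comm]
  have natDegree_eq : p.natDegree = F.natDegree :=
    hd.antisymm (finrank_eq ▸ h.finrank_le_natDegree const_smul hp hv spans)
  exact ⟨natDegree_eq, IsSkewModel.norm_coeff_zero_of_smul_eq_zero const_smul hp hv h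
    hS.toIsCyclicSetting spans finrank_eq natDegree_eq⟩

lemma isSpreadSet_skewCode
    (hu : ∀ p ∈ codePoly F.natDegree φ, p ≠ 0 → IsUnit (p.eval₂ ι t)) :
    IsSpreadSet (skewCode ι t F.natDegree φ : Set (Matrix (Fin n) (Fin n) E)) where
  zero_mem := zero_mem _
  add_mem _ hX _ hY := add_mem hX hY
  neg_mem _ hX := neg_mem hX
  isUnit := by
    rintro _ ⟨p, hp, rfl⟩ hne
    exact hu p hp fun h0 => hne (by rw [h0, map_zero])
  card_eq := by
    rw [SetLike.coe_sort_coe, h.natCard_skewCode hS.natDegree_pos hS.natDegree_lt, Nat.card_fun,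
      Nat.card_fin, hE, hS.natCard_eq_pow, ← pow_mul, ← pow_mul, mul_comm]

theorem isSpreadSet_skewCode_zero :
    IsSpreadSet (skewCode ι t F.natDegree 0 : Set (Matrix (Fin n) (Fin n) E)) :=
  isSpreadSet_skewCode hS h hE fun p hp hp0 => by
    by_contra hu
    exact (natDegree_lt_of_coeff_eq_zero hS.natDegree_pos hp.1 hp.2).ne
      (norm_coeff_zero_of_not_isUnit hS h hE hp0 hp.1 hu).1

theorem isSpreadSet_skewCode_of_norm_ne_one {η : L} {ρ : L ≃+* L} (K' : Subfield K)
    (hρ : ∀ c ∈ K', ρ (algebraMap K L c) = algebraMap K L c) (hφ : ∀ a, φ a = η * ρ a)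
    (hη : Algebra.norm K' η *
      Algebra.norm K' ((-1) ^ (F.natDegree * (n - 1)) * F.coeff 0) ≠ 1) :
    IsSpreadSet (skewCode ι t F.natDegree φ : Set (Matrix (Fin n) (Fin n) E)) :=
  isSpreadSet_skewCode hS h hE fun p hp hp0 => by
    have : Finite K := Finite.of_injective _ (algebraMap K L).injective
    by_contra hu
    obtain ⟨hd, norm_eq⟩ := norm_coeff_zero_of_not_isUnit hS h hE hp0 hp.1 hu
    have coeff_zero_ne_zero : p.coeff 0 ≠ 0 := fun h0 =>
      (natDegree_lt_of_mem_codePoly hS.natDegree_pos hp h0).ne hd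
    have norm_ρ (a : L) : Algebra.norm K' (ρ a) = Algebra.norm K' a :=
      Algebra.norm_eq_of_algEquiv
        (AlgEquiv.ofRingEquiv (f := ρ) fun c => hρ c.1 c.2 : L ≃ₐ[K'] L) a
    have norm_K'_eq := congrArg (Algebra.norm K') norm_eq
    rw [leadingCoeff, hd, hp.2, hφ, map_mul (Algebra.norm K') _ (Algebra.norm K _),
      Algebra.norm_norm, Algebra.norm_norm, map_mul _ η, norm_ρ] at norm_K'_eq
    refine hη (mul_right_cancel₀ (Algebra.norm_ne_zero_iff.2 coeff_zero_ne_zero) ?_)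
    rw [one_mul]
    conv_rhs => rw [norm_K'_eq]
    ring

end SpreadSet

section Idealizer

variable {Q : Type*} [Ring Q]

/-- The left idealizer `{z | z C ⊆ C}` of an additive subgroup `C` of a ring. -/
def leftIdealizer (C : AddSubgroup Q) : Subring Q where
  carrier := {z | ∀ c ∈ C, z * c ∈ C}
  one_mem' c hc := by rwa [one_mul]
  mul_mem' hy hz c hc := by rw [mul_assoc]; exact hy _ (hz _ hc)
  zero_mem' c _ := by rw [zero_mul]; exact C.zero_mem
  add_mem' hy hz c hc := by rw [add_mul]; exact C.add_mem (hy c hc) (hz c hc)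
  neg_mem' hz c hc := by rw [neg_mul]; exact C.neg_mem (hz c hc)

/-- The right idealizer `{z | C z ⊆ C}` of an additive subgroup `C` of a ring. -/
def rightIdealizer (C : AddSubgroup Q) : Subring Q where
  carrier := {z | ∀ c ∈ C, c * z ∈ C}
  one_mem' c hc := by rwa [mul_one]
  mul_mem' hy hz c hc := by rw [← mul_assoc]; exact hz _ (hy _ hc)
  zero_mem' c _ := by rw [mul_zero]; exact C.zero_mem
  add_mem' hy hz c hc := by rw [mul_add]; exact C.add_mem (hy c hc) (hz c hc)
  neg_mem' hz c hc := by rw [mul_neg]; exact C.neg_mem (hz c hc)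

lemma isUnit_of_mem_leftIdealizer {C : AddSubgroup Q} (hC : ∀ c ∈ C, c ≠ 0 → IsUnit c) {u z : Q}
    (hu : IsUnit u) (huC : u ∈ C) (hz : z ∈ leftIdealizer C) (hz0 : z ≠ 0) : IsUnit z := by
  have hzu : z * u ≠ 0 := fun h0 => hz0 (hu.mul_left_eq_zero.1 h0)
  rw [← hu.unit_spec] at hzu huC
  exact (hu.unit.isUnit_mul_units z).1 (hC _ (hz _ huC) hzu)

lemma commute_of_forall_isUnit {B : Subring Q} [Finite B] (hB : ∀ z ∈ B, z ≠ 0 → IsUnit z)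
    {y z : Q} (hy : y ∈ B) (hz : z ∈ B) : Commute y z := by
  rcases subsingleton_or_nontrivial Q with hQ | hQ
  · exact Subsingleton.elim _ _
  have : NoZeroDivisors B := ⟨fun {x y} hxy => or_iff_not_imp_left.2 fun hx => by
    have hx' := hB x x.2 fun h0 => hx (Subtype.ext h0)
    exact Subtype.ext (hx'.mul_right_eq_zero.1 (congrArg Subtype.val hxy))⟩
  have : IsDomain B := NoZeroDivisors.to_isDomain B
  exact congrArg Subtype.val ((Finite.isDomain_to_isField B).mul_comm ⟨y, hy⟩ ⟨z, hz⟩)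

end Idealizer

section LeftIdealizer

variable {K L : Type*} [Field K] [Field L] [Algebra K L] {Q : Type*} [Ring Q]
  {σ : L ≃ₐ[K] L} {n : ℕ} {F : K[X]} {ι : L →+* Q} {t : Q} {φ : L →+ L}

namespace IsSkewModel

variable (h : IsSkewModel σ n F ι t) (hS : IsCodeSetting σ n F)
include h hS

lemma const_mem_leftIdealizer_iff {a : L} :
    ι a ∈ leftIdealizer (skewCode ι t F.natDegree φ) ↔ ∀ b, φ (a * b) = a * φ b := by
  constructor
  · intro ha b
    have mem := ha _ (eval₂_mem_skewCode (C_add_mem_codePoly hS.natDegree_pos b))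
    rw [← eval₂_C_mul, h.eval₂_mem_skewCode_iff hS.natDegree_lt] at mem
    · simpa [coeff_C, coeff_X_pow, hS.natDegree_pos.ne, hS.natDegree_pos.ne'] using mem.2.symm
    · exact ((natDegree_C_mul_le _ _).trans
        (C_add_mem_codePoly hS.natDegree_pos b).1).trans_lt hS.natDegree_lt
  · rintro ha _ ⟨p, hp, rfl⟩
    change ι a * p.eval₂ ι t ∈ _
    rw [← eval₂_C_mul]
    refine eval₂_mem_skewCode ⟨(natDegree_C_mul_le _ _).trans hp.1, ?_⟩
    rw [coeff_C_mul, coeff_C_mul, hp.2, ha]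

/- Multiplication by `x ^ (s - 1)` takes `p` to an element of the code with constant term `0`. -/
lemma natDegree_eq_zero_of_mem_leftIdealizer {p : L[X]} (hp : p.natDegree < F.natDegree)
    (hz : p.eval₂ ι t ∈ leftIdealizer (skewCode ι t F.natDegree φ)) : p.natDegree = 0 := by
  obtain ⟨k, hk⟩ := Nat.exists_eq_add_of_lt hS.one_lt
  have hN := hS.two_mul_natDegree_le
  have mem := hz _ (const_mul_pow_mem_skewCode (k := k + 1) (Nat.succ_pos k) (by omega) 1)
  rw [map_one, one_mul, ← eval₂_mul_X_pow] at mem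
  have natDegree_le := natDegree_mul_le (p := p) (q := X ^ (k + 1))
  rw [natDegree_X_pow] at natDegree_le
  have natDegree_lt := natDegree_lt_of_mem_codePoly hS.natDegree_pos
    ((h.eval₂_mem_skewCode_iff hS.natDegree_lt (by omega)).1 mem)
    (by rw [coeff_mul_X_pow', if_neg (by omega)])
  rcases eq_or_ne p 0 with rfl | hp0
  · exact natDegree_zero
  · rw [natDegree_mul_X_pow _ hp0] at natDegree_lt
    omega

/- Compare constant and leading coefficients in `z c x = (z x) (x⁻¹ c x)`, where
`c = σ b + φ(σ b) x²` is in the code. -/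
lemma coeff_zero_mul_eq_of_mem_leftIdealizer (hs : F.natDegree = 2) {z : Q} {p : L[X]}
    (hz : z ∈ leftIdealizer (skewCode ι t F.natDegree φ)) (hp : p ∈ codePoly F.natDegree φ)
    (hpz : p.eval₂ ι t = z * t) (hn : 0 < n) (b : L) :
    p.coeff 0 * b =
      (if n = 2 then φ (p.coeff 0) * σ (φ (σ b)) else 0) * algebraMap K L (F.coeff 0) := by
  have two_le := hS.two_le
  rw [hs] at hz hp
  have natDegree_p : p.natDegree ≤ 2 := hp.1
  obtain ⟨d, hd, hdz⟩ := hz _ (const_add_mem_skewCode two_pos (σ b))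
  have natDegree_d : d.natDegree ≤ 2 := hd.1
  replace hdz : d.eval₂ ι t = z * (ι (σ b) + ι (φ (σ b)) * t ^ 2) := hdz
  set c := σ.symm (φ (σ b)) with hc
  have eval₂_eq_zero : (twist σ p b + twist σ p c * X ^ 2 - d * X).eval₂ ι t = 0 := by
    rw [eval₂_sub, eval₂_add, eval₂_mul_X_pow, eval₂_mul_X, ← h.eval₂_mul_apply,
      ← h.eval₂_mul_apply, hpz, hdz, mul_assoc z, mul_assoc z, h.mul_apply, h.mul_apply, hc,
      AlgEquiv.apply_symm_apply]
    simp only [mul_add, add_mul, mul_assoc, ← pow_succ, ← pow_succ', sub_self]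
  have natDegree_le : (twist σ p b + twist σ p c * X ^ 2 - d * X).natDegree ≤ 4 := by
    have := natDegree_twist_le σ p b
    have := natDegree_twist_le σ p c
    compute_degree
    all_goals omega
  have coeff_zero_eq :=
    h.coeff_zero_of_natDegree_le hn hS.monic (by rw [hs]; omega) eval₂_eq_zero
  convert coeff_zero_eq using 2
  · simp [coeff_twist]
  · split_ifs with hn2
    · have coeff_four : p.coeff (2 * 2) = 0 := coeff_eq_zero_of_natDegree_lt (by omega)
      have coeff_three : d.coeff 3 = 0 := coeff_eq_zero_of_natDegree_lt (by omega)
      rw [hs, hn2, coeff_sub, coeff_mul_X d 3, coeff_add, coeff_mul_X_pow (twist σ p c) 2 2,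
        coeff_three, sub_zero, coeff_twist, coeff_four, zero_mul, zero_add, coeff_twist, hp.2,
        sq, AlgEquiv.mul_apply, hc, AlgEquiv.apply_symm_apply]
    · exact (coeff_eq_zero_of_natDegree_lt (natDegree_le.trans_lt (by rw [hs]; omega))).symm

variable [Finite L]

lemma map_mul_of_coeff_zero_ne_zero (hs : F.natDegree = 2) {z : Q} {p : L[X]}
    (hz : z ∈ leftIdealizer (skewCode ι t F.natDegree φ)) (hp : p ∈ codePoly F.natDegree φ)
    (hpz : p.eval₂ ι t = z * t) (h0 : p.coeff 0 ≠ 0) :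
    n = 2 ∧ ∀ a b, φ (a * b) = a * φ b := by
  have coeff_eq := h.coeff_zero_mul_eq_of_mem_leftIdealizer hS hs hz hp hpz hS.pos
  have hn2 : n = 2 := by
    by_contra hn2
    exact h0 (by simpa [hn2] using coeff_eq 1)
  simp only [if_pos hn2] at coeff_eq
  have ne_zero : φ (p.coeff 0) * algebraMap K L (F.coeff 0) ≠ 0 := fun h1 => h0 <| by
    rw [← mul_one (p.coeff 0), coeff_eq, mul_right_comm, h1, zero_mul]
  have mul_map_eq (b : L) :
      φ (p.coeff 0) * algebraMap K L (F.coeff 0) * σ (φ b) = p.coeff 0 * σ b := by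
    rw [coeff_eq, ← AlgEquiv.mul_apply σ σ, ← sq, ← hn2, hS.pow_eq_one, AlgEquiv.one_apply,
      mul_right_comm]
  refine ⟨hn2, fun a b => σ.injective (mul_left_cancel₀ ne_zero ?_)⟩
  rw [mul_map_eq, map_mul σ, mul_left_comm, map_mul σ, mul_left_comm _ (σ a), mul_map_eq]

variable (hu : ∀ c ∈ skewCode ι t F.natDegree φ, c ≠ 0 → IsUnit c)
include hu

/- If the constant term of `z x` were not zero, then `φ` would be linear, and `L` would be contained
in the left idealizer, which is commutative by Wedderburn's theorem. -/
lemma coeff_zero_eq_zero_of_natDegree_eq_two (hs : F.natDegree = 2) {z : Q} {p : L[X]}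
    (hz : z ∈ leftIdealizer (skewCode ι t F.natDegree φ)) (hp : p ∈ codePoly F.natDegree φ)
    (hpz : p.eval₂ ι t = z * t) : p.coeff 0 = 0 := by
  by_contra h0
  obtain ⟨hn, map_mul⟩ := h.map_mul_of_coeff_zero_ne_zero hS hs hz hp hpz h0
  have hN : n * F.natDegree = 4 := by rw [hn, hs]
  have : Finite Q := h.finite hS.mul_natDegree_pos hS.monic
  have commute_const (a : L) : Commute z (ι a) :=
    commute_of_forall_isUnit (fun _ => isUnit_of_mem_leftIdealizer hu
      (h.isUnit_var hS.toIsCyclicSetting) (var_mem_skewCode hS.one_lt)) hz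
      ((h.const_mem_leftIdealizer_iff hS).2 (map_mul a))
  obtain ⟨r, hr, rfl⟩ := h.exists_natDegree_lt hS.mul_natDegree_pos hS.monic z
  have coeff_three : r.coeff 3 = 0 := by
    by_contra h3
    have hdvd := h.dvd_of_commute_const hS.toIsCyclicSetting hr commute_const h3
    rw [hn] at hdvd
    omega
  have natDegree_r : r.natDegree < 3 :=
    natDegree_lt_of_coeff_eq_zero three_pos (by rw [hN] at hr; omega) coeff_three
  have p_eq : p = r * X := by
    refine h.eq_of_natDegree_lt (hp.1.trans_lt hS.natDegree_lt) ?_ (by rw [hpz, eval₂_mul_X])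
    exact (natDegree_mul_le.trans (Nat.add_le_add_left natDegree_X_le _)).trans_lt (by omega)
  exact h0 (by rw [p_eq, coeff_mul_X_zero])

lemma coeff_zero_eq_zero_of_mem_leftIdealizer (hφ : Function.Injective φ) {z : Q} {p : L[X]}
    (hz : z ∈ leftIdealizer (skewCode ι t F.natDegree φ)) (hp : p ∈ codePoly F.natDegree φ)
    (hpz : p.eval₂ ι t = z * t) : p.coeff 0 = 0 := by
  obtain hs | hs : F.natDegree = 2 ∨ 2 < F.natDegree := by have := hS.one_lt; omega
  · exact h.coeff_zero_eq_zero_of_natDegree_eq_two hS hu hs hz hp hpz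
  have hN := hS.two_mul_natDegree_le
  have natDegree_le : (p * X).natDegree ≤ F.natDegree + 1 :=
    natDegree_mul_le.trans (Nat.add_le_add hp.1 natDegree_X_le)
  have mem := hz _ (const_mul_pow_mem_skewCode two_pos hs 1)
  rw [map_one, one_mul, sq, ← mul_assoc, ← hpz, ← eval₂_mul_X,
    h.eval₂_mem_skewCode_iff hS.natDegree_lt (by omega)] at mem
  have natDegree_lt := natDegree_lt_of_mem_codePoly hS.natDegree_pos mem (coeff_mul_X_zero p)
  refine hφ ?_
  rw [map_zero, ← hp.2, ← coeff_mul_X, coeff_eq_zero_of_natDegree_lt (by omega)]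

lemma exists_natDegree_lt_of_mem_leftIdealizer (hφ : φ = 0 ∨ Function.Injective φ) {z : Q}
    (hz : z ∈ leftIdealizer (skewCode ι t F.natDegree φ)) :
    ∃ p : L[X], p.natDegree < F.natDegree ∧ p.eval₂ ι t = z := by
  rcases hφ with rfl | hφ
  · obtain ⟨p, hp, hpz⟩ := hz _ (const_add_mem_skewCode hS.natDegree_pos 1)
    refine ⟨p, natDegree_lt_of_coeff_eq_zero hS.natDegree_pos hp.1 hp.2, ?_⟩
    simpa using hpz
  · obtain ⟨p, hp, hpz⟩ := hz _ (var_mem_skewCode hS.one_lt)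
    replace hpz : p.eval₂ ι t = z * t := hpz
    have coeff_zero := h.coeff_zero_eq_zero_of_mem_leftIdealizer hS hu hφ hz hp hpz
    refine ⟨p.divX, ?_, (h.isUnit_var hS.toIsCyclicSetting).mul_right_cancel ?_⟩
    · have := natDegree_lt_of_mem_codePoly hS.natDegree_pos hp coeff_zero
      exact (natDegree_divX_le).trans_lt this
    · have divX_mul_X : p.divX * X = p := by simpa [coeff_zero] using divX_mul_X_add p
      rw [← eval₂_mul_X, divX_mul_X, hpz]

theorem coe_leftIdealizer_skewCode (hφ : φ = 0 ∨ Function.Injective φ) :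
    (leftIdealizer (skewCode ι t F.natDegree φ) : Set Q) =
      ι '' {a | ∀ b, φ (a * b) = a * φ b} := by
  ext z
  constructor
  · intro hz
    obtain ⟨p, hp, rfl⟩ := h.exists_natDegree_lt_of_mem_leftIdealizer hS hu hφ hz
    obtain ⟨a, rfl⟩ := natDegree_eq_zero.1 (h.natDegree_eq_zero_of_mem_leftIdealizer hS hp hz)
    rw [eval₂_C] at hz ⊢
    exact ⟨a, (h.const_mem_leftIdealizer_iff hS).1 hz, rfl⟩
  · rintro ⟨a, ha, rfl⟩
    exact (h.const_mem_leftIdealizer_iff hS).2 ha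

end IsSkewModel

end LeftIdealizer

section Opposite

variable {K L : Type*} [Field K] [Field L] [Algebra K L] {Q : Type*} [Ring Q]
  {σ : L ≃ₐ[K] L} {n : ℕ} {F : K[X]} {ι : L →+* Q} {t : Q} {φ : L →+ L}

/-- The polynomial with coefficients `σ ^ m (p_m)`: if `p` lists the coefficients of a skew
polynomial written on the right, this lists the coefficients written on the left. -/
noncomputable def powTwist (σ : L ≃ₐ[K] L) (p : L[X]) : L[X] :=
  ∑ m ∈ p.support, monomial m ((σ ^ m) (p.coeff m))

lemma coeff_powTwist (σ : L ≃ₐ[K] L) (p : L[X]) (m : ℕ) :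
    (powTwist σ p).coeff m = (σ ^ m) (p.coeff m) := by
  simp only [powTwist, finsetSum_coeff, coeff_monomial]
  rw [Finset.sum_ite_eq' p.support m]
  split_ifs with h
  · rfl
  · rw [notMem_support_iff.1 h, map_zero]

lemma powTwist_powTwist_inv (σ : L ≃ₐ[K] L) (p : L[X]) : powTwist σ (powTwist σ⁻¹ p) = p := by
  ext m
  rw [coeff_powTwist, coeff_powTwist, inv_pow]
  exact (σ ^ m).apply_symm_apply _

lemma natDegree_powTwist_le_iff {p : L[X]} {s : ℕ} :
    (powTwist σ p).natDegree ≤ s ↔ p.natDegree ≤ s := by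
  simp only [natDegree_le_iff_coeff_eq_zero, coeff_powTwist, EmbeddingLike.map_eq_zero_iff]

lemma powTwist_expandMap_mul (hn : 0 < n) (hσ : σ ^ n = 1) (F : K[X]) (q : L[X]) :
    powTwist σ (expandMap L n F * q) = expandMap L n F * powTwist σ q := by
  ext k
  rw [coeff_powTwist, coeff_mul, coeff_mul, map_sum]
  refine Finset.sum_congr rfl fun x hx => ?_
  rw [map_mul, coeff_powTwist, coeff_map, AlgEquiv.commutes,
    ← Finset.HasAntidiagonal.mem_antidiagonal.1 hx, coeff_expand hn]
  split_ifs with hx1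
  · obtain ⟨l, hl⟩ := hx1
    rw [pow_add, hl, pow_mul, hσ, one_pow, one_mul]
  · simp only [map_zero, zero_mul]

lemma expandMap_dvd_powTwist_iff (hn : 0 < n) (hσ : σ ^ n = 1) {F : K[X]} {p : L[X]} :
    expandMap L n F ∣ powTwist σ p ↔ expandMap L n F ∣ p := by
  constructor
  · rintro ⟨q, hq⟩
    refine ⟨powTwist σ⁻¹ q, ?_⟩
    have hσ' : σ⁻¹ ^ n = 1 := by rw [inv_pow, hσ, inv_one]
    rw [← powTwist_expandMap_mul hn hσ', ← hq]
    conv_lhs => rw [← powTwist_powTwist_inv σ⁻¹ p, inv_inv]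
  · rintro ⟨q, rfl⟩
    exact ⟨_, powTwist_expandMap_mul hn hσ F q⟩

lemma powTwist_mem_codePoly_iff {s : ℕ} {ψ : L →+ L} (hψ : ∀ a, (σ ^ s) (ψ a) = φ a)
    {p : L[X]} : powTwist σ p ∈ codePoly s φ ↔ p ∈ codePoly s ψ := by
  refine and_congr natDegree_powTwist_le_iff ?_
  rw [coeff_powTwist, coeff_powTwist, ← hψ, (σ ^ s).injective.eq_iff]
  rfl

/-- The homomorphism `ι`, seen as a homomorphism to the opposite ring. -/
abbrev opHom (ι : L →+* Q) : L →+* Qᵐᵒᵖ :=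
  ι.toOpposite fun a b => (Commute.all a b).map ι

lemma IsSkewPair.eval₂_op (h : IsSkewPair σ ι t) (p : L[X]) :
    p.eval₂ (opHom ι) (.op t) = .op ((powTwist σ p).eval₂ ι t) := by
  rw [powTwist, eval₂_finsetSum, Finset.op_sum, eval₂_eq_sum, sum_def]
  refine Finset.sum_congr rfl fun m _ => ?_
  rw [eval₂_monomial, ← h.pow_mul_apply]
  rfl

lemma IsSkewModel.op (h : IsSkewModel σ n F ι t) (hn : 0 < n) (hσ : σ ^ n = 1) :
    IsSkewModel σ⁻¹ n F (opHom ι) (.op t) where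
  mul_apply a := MulOpposite.unop_injective <| by
    refine Eq.trans ?_ (h.mul_apply (σ⁻¹ a)).symm
    exact congrArg (ι · * t) (σ.apply_symm_apply a).symm
  eval₂_eq_zero_iff p := by
    rw [h.eval₂_op, MulOpposite.op_eq_zero_iff, h.eval₂_eq_zero_iff,
      expandMap_dvd_powTwist_iff hn hσ]
  eval₂_surjective q := by
    obtain ⟨p, hp⟩ := h.eval₂_surjective q.unop
    exact ⟨powTwist σ⁻¹ p, by rw [h.eval₂_op, powTwist_powTwist_inv, hp, MulOpposite.op_unop]⟩

lemma IsCodeSetting.inv (hS : IsCodeSetting σ n F) : IsCodeSetting σ⁻¹ n F where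
  __ := hS
  mem_zpowers τ := by rw [Subgroup.zpowers_inv]; exact hS.mem_zpowers τ

lemma IsSkewPair.op_mem_skewCode_iff (h : IsSkewPair σ ι t) {s : ℕ} {ψ : L →+ L}
    (hψ : ∀ a, (σ ^ s) (ψ a) = φ a) {q : Q} :
    .op q ∈ skewCode (opHom ι) (.op t) s ψ ↔ q ∈ skewCode ι t s φ := by
  constructor
  · rintro ⟨p, hp, hpq⟩
    refine ⟨powTwist σ p, (powTwist_mem_codePoly_iff hψ).2 hp, MulOpposite.op_injective ?_⟩
    rw [← hpq]
    exact (h.eval₂_op p).symm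
  · rintro ⟨p, hp, rfl⟩
    rw [← powTwist_powTwist_inv σ p] at hp
    refine ⟨powTwist σ⁻¹ p, (powTwist_mem_codePoly_iff hψ).1 hp, ?_⟩
    change eval₂ _ _ _ = MulOpposite.op (eval₂ _ _ _)
    rw [h.eval₂_op, powTwist_powTwist_inv]

/- The opposite ring carries a skew model over `σ⁻¹` in which left and right idealizers are
interchanged. -/
theorem IsSkewModel.coe_rightIdealizer_skewCode [Finite L] (h : IsSkewModel σ n F ι t)
    (hS : IsCodeSetting σ n F) (hu : ∀ c ∈ skewCode ι t F.natDegree φ, c ≠ 0 → IsUnit c)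
    (hφ : φ = 0 ∨ Function.Injective φ) :
    (rightIdealizer (skewCode ι t F.natDegree φ) : Set Q) =
      ι '' {a | ∀ b, φ (a * b) = (σ ^ F.natDegree) a * φ b} := by
  set τ := σ ^ F.natDegree
  let ψ : L →+ L := (τ.symm : L →+ L).comp φ
  have hψ (a : L) : τ (ψ a) = φ a := τ.apply_symm_apply _
  have op_mem_iff {q : Q} := h.op_mem_skewCode_iff (q := q) hψ
  have hψ0 : ψ = 0 ∨ Function.Injective ψ :=
    hφ.imp (fun h0 => by simp only [ψ, h0, AddMonoidHom.comp_zero]) τ.symm.injective.comp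
  have coe_eq := (h.op hS.pos hS.pow_eq_one).coe_leftIdealizer_skewCode hS.inv
    (fun c hc hc0 => isUnit_unop.1 <|
      hu _ (op_mem_iff.1 hc) ((MulOpposite.unop_ne_zero_iff c).2 hc0)) hψ0
  ext z
  have mem_iff : z ∈ rightIdealizer (skewCode ι t F.natDegree φ) ↔
      .op z ∈ leftIdealizer (skewCode (opHom ι) (.op t) F.natDegree ψ) := by
    refine MulOpposite.opEquiv.forall_congr fun c => ?_
    exact (imp_congr op_mem_iff op_mem_iff).symm
  rw [SetLike.mem_coe, mem_iff, ← SetLike.mem_coe, coe_eq]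
  refine exists_congr fun a => and_congr (forall_congr' fun b => ?_) MulOpposite.op_inj
  rw [← τ.injective.eq_iff, hψ, map_mul τ, hψ]

end Opposite

section Generation

lemma units_inv_mem {Q : Type*} [Ring Q] [Finite Q] {B : Subring Q} {u : Qˣ}
    (hu : (u : Q) ∈ B) : ((u⁻¹ : Qˣ) : Q) ∈ B := by
  obtain ⟨k, hk⟩ := mem_powers_iff_mem_zpowers.2 (inv_mem (Subgroup.mem_zpowers u))
  rw [← hk]
  exact pow_mem hu k

variable {K L : Type*} [Field K] [Field L] [Algebra K L] {Q : Type*} [Ring Q]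
  {σ : L ≃ₐ[K] L} {n : ℕ} {F : K[X]} {ι : L →+* Q} {φ : L →+ L} {u : Qˣ} {B : Subring Q}

lemma mem_of_const_mul_mem (hι : ∀ a, ι a ∈ B) {a : L} (ha : a ≠ 0) {z : Q} (hz : ι a * z ∈ B) :
    z ∈ B := by
  have mem := B.mul_mem (hι a⁻¹) hz
  rwa [← mul_assoc, ← map_mul, inv_mul_cancel₀ ha, map_one, one_mul] at mem

namespace IsSkewPair

variable (h : IsSkewPair σ ι (u : Q))
include h

lemma inv_mul_apply (a : L) : ↑u⁻¹ * ι (σ a) = ι a * ↑u⁻¹ := by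
  rw [Units.inv_mul_eq_iff_eq_mul, ← mul_assoc, h.mul_apply, Units.mul_inv_cancel_right]

lemma mul_inv_add (η : L) : u * (↑u⁻¹ + ι η * u) = 1 + ι (σ η) * u ^ 2 := by
  rw [mul_add, Units.mul_inv, ← mul_assoc, h.mul_apply, mul_assoc, sq]

lemma inv_add (hσ : σ ^ 2 = 1) (η : L) : IsSkewPair σ ι (↑u⁻¹ + ι η * u) where
  mul_apply a := by
    have σ_σ : σ (σ a) = a := by rw [← AlgEquiv.mul_apply, ← sq, hσ, AlgEquiv.one_apply]
    conv_lhs => rw [add_mul, ← σ_σ, h.inv_mul_apply, σ_σ, mul_assoc, h.mul_apply]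
    rw [mul_add, ← mul_assoc, ← mul_assoc, ← map_mul, ← map_mul, mul_comm η]

lemma const_mem (hs : 1 < F.natDegree)
    (hB : ∀ c ∈ skewCode ι u F.natDegree φ, ↑u⁻¹ * c ∈ B) (a : L) : ι a ∈ B := by
  have mem := hB _ (const_mul_pow_mem_skewCode one_pos hs (σ a))
  rwa [pow_one, ← h.mul_apply, Units.inv_mul_cancel_left] at mem

lemma inv_add_mem (hs : F.natDegree = 2)
    (hB : ∀ c ∈ skewCode ι u F.natDegree φ, ↑u⁻¹ * c ∈ B) {a b : L} (hab : φ (σ a) = σ b) :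
    ι a * ↑u⁻¹ + ι b * u ∈ B := by
  rw [hs] at hB
  have mem := hB _ (const_add_mem_skewCode two_pos (σ a))
  rwa [hab, mul_add, h.inv_mul_apply, ← mul_assoc, h.inv_mul_apply, mul_assoc, sq,
    Units.inv_mul_cancel_left] at mem

end IsSkewPair

namespace IsSkewModel

variable (h : IsSkewModel σ n F ι (u : Q))
include h

lemma eq_top_of_mem (hι : ∀ a, ι a ∈ B) (hu : (u : Q) ∈ B) : B = ⊤ := by
  refine eq_top_iff.2 fun q _ => ?_
  obtain ⟨p, rfl⟩ := h.eval₂_surjective q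
  rw [eval₂_eq_sum, sum_def]
  exact B.sum_mem fun m _ => B.mul_mem (hι _) (B.pow_mem hu m)

lemma exists_eq_mul_add_inv_add (hs : F.natDegree = 2) {η : L}
    (hφ : ∀ c, φ c = σ η * c) {c : Q} (hc : c ∈ skewCode ι u F.natDegree φ) :
    ∃ a b, c = u * (ι a + ι b * (↑u⁻¹ + ι η * u)) := by
  obtain ⟨p, hp, rfl⟩ := hc
  rw [hs] at hp
  refine ⟨σ.symm (p.coeff 1), σ.symm (p.coeff 0), ?_⟩
  change p.eval₂ ι u = _
  rw [mul_add, h.mul_apply, ← mul_assoc, h.mul_apply, mul_assoc, h.mul_inv_add,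
    AlgEquiv.apply_symm_apply, AlgEquiv.apply_symm_apply, mul_add, mul_one, ← mul_assoc, ← map_mul,
    mul_comm (p.coeff 0), ← hφ, ← hp.2, eval₂_eq_sum_range' ι (Nat.lt_succ_of_le hp.1)]
  simp only [Finset.sum_range_succ, Finset.sum_range_zero, pow_zero, pow_one, mul_one]
  abel

variable (hS : IsCodeSetting σ n F)
include hS

lemma inv_add_ne_const (hs : F.natDegree = 2) (η c : L) : ↑u⁻¹ + ι η * u ≠ ι c := by
  intro heq
  have natDegree_lt := hs ▸ hS.natDegree_lt
  replace heq := congrArg ((u : Q) * ·) heq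
  simp only [h.mul_inv_add, h.mul_apply] at heq
  have poly_eq : (1 + C (σ η) * X ^ 2 : L[X]) = C (σ c) * X := by
    refine h.eq_of_natDegree_lt ?_ ?_ ?_
    · rw [hs]
      refine lt_of_le_of_lt ?_ natDegree_lt
      compute_degree
    · rw [hs]
      refine lt_of_le_of_lt ?_ natDegree_lt
      compute_degree
      norm_num
    · simpa [eval₂_C_mul] using heq
  simpa using congrArg (coeff · 0) poly_eq

/- The even powers of `x` are the ones that commute with `L`. -/
lemma exists_inv_add_sq_eq [Finite L] (hn : n = 2) (hs : F.natDegree = 2) (η : L) :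
    ∃ a b, (↑u⁻¹ + ι η * u) ^ 2 = ι a + ι b * u ^ 2 := by
  have hσ : σ ^ 2 = 1 := hn ▸ hS.pow_eq_one
  have commute_const := (h.inv_add hσ η).commute_pow hσ
  obtain ⟨r, hr, hrw⟩ := h.exists_natDegree_lt hS.mul_natDegree_pos hS.monic
    ((↑u⁻¹ + ι η * u) ^ 2)
  rw [← hrw] at commute_const ⊢
  have coeff_odd {m : ℕ} (hm : ¬ 2 ∣ m) : r.coeff m = 0 := by
    rw [← hn] at hm
    by_contra hne
    exact hm (h.dvd_of_commute_const hS.toIsCyclicSetting hr commute_const hne)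
  refine ⟨r.coeff 0, r.coeff 2, ?_⟩
  rw [hn, hs] at hr
  rw [eval₂_eq_sum_range' ι hr]
  simp [Finset.sum_range_succ, coeff_odd (m := 1) (by omega), coeff_odd (m := 3) (by omega)]

section Linear

variable {η : L} (hφ : ∀ c, φ c = σ η * c)
include hφ

lemma mul_add_inv_add_mem (hs : F.natDegree = 2) (a b : L) :
    u * (ι a + ι b * (↑u⁻¹ + ι η * u)) ∈ skewCode ι u F.natDegree φ := by
  have mem := add_mem (const_mul_pow_mem_skewCode (ι := ι) (t := u) (φ := φ) one_pos hS.one_lt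
    (σ a)) (const_add_mem_skewCode hS.natDegree_pos (σ b))
  convert mem using 1
  rw [mul_add, h.mul_apply, pow_one, ← mul_assoc, h.mul_apply, mul_assoc, h.mul_inv_add, hs, hφ,
    mul_add, mul_one, ← mul_assoc, ← map_mul, mul_comm (σ b)]

variable [Finite L] (hu : ∀ c ∈ skewCode ι (u : Q) F.natDegree φ, c ≠ 0 → IsUnit c)
include hu

/- If `w ^ 2` were a constant, where `w = x⁻¹ + η x`, then `x⁻¹ C = L + L w` would be a ring, and
`x w x⁻¹` would lie in the left idealizer of `C`, which consists of constants. -/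
lemma inv_add_sq_ne_const (hn : n = 2) (hs : F.natDegree = 2) (hη : η ≠ 0) (k : L) :
    (↑u⁻¹ + ι η * u) ^ 2 ≠ ι k := by
  intro hk
  have hw := h.inv_add (hn ▸ hS.pow_eq_one) η
  set w := ↑u⁻¹ + ι η * u with hwdef
  have mem : u * w * ↑u⁻¹ ∈ leftIdealizer (skewCode ι u F.natDegree φ) := by
    intro c hc
    obtain ⟨a, b, rfl⟩ := h.exists_eq_mul_add_inv_add hs hφ hc
    convert h.mul_add_inv_add_mem hS hφ hs (σ b * k) (σ a) using 1
    rw [← hwdef, mul_assoc, Units.inv_mul_cancel_left, mul_assoc, mul_add, hw.mul_apply,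
      ← mul_assoc w, hw.mul_apply, mul_assoc _ w, ← sq, hk, map_mul, add_comm]
  have φ_injective : Function.Injective φ := fun a b hab => by
    rw [hφ, hφ] at hab
    exact mul_left_cancel₀ ((map_ne_zero σ).2 hη) hab
  rw [← SetLike.mem_coe, h.coe_leftIdealizer_skewCode hS hu (Or.inr φ_injective)] at mem
  obtain ⟨a, -, ha⟩ := mem
  refine h.inv_add_ne_const hS hs η (σ.symm a) ?_
  rw [Units.eq_mul_inv_iff_mul_eq, ← σ.apply_symm_apply a, ← h.mul_apply] at ha
  exact (u.isUnit.mul_left_cancel ha).symm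

lemma var_mem_of_linear (hn : n = 2) (hs : F.natDegree = 2) (hη : η ≠ 0) (hι : ∀ a, ι a ∈ B)
    (hw : ↑u⁻¹ + ι η * u ∈ B) : (u : Q) ∈ B := by
  have : Finite Q := h.finite hS.mul_natDegree_pos hS.monic
  obtain ⟨a, b, sq_eq⟩ := h.exists_inv_add_sq_eq hS hn hs η
  have hb : b ≠ 0 := by
    rintro rfl
    rw [map_zero, zero_mul, add_zero] at sq_eq
    exact h.inv_add_sq_ne_const hS hφ hu hn hs hη a sq_eq
  have sq_mem : (u : Q) ^ 2 ∈ B := by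
    have mem := B.sub_mem (B.pow_mem hw 2) (hι a)
    rw [sq_eq, add_sub_cancel_left] at mem
    exact mem_of_const_mul_mem hι hb mem
  obtain ⟨w, hw_eq⟩ : IsUnit (↑u⁻¹ + ι η * u) := by
    rw [← u.isUnit_units_mul]
    have mem := h.mul_add_inv_add_mem hS hφ hs 0 1
    rw [map_zero, map_one, one_mul, zero_add] at mem
    refine hu _ mem fun h0 => h.inv_add_ne_const hS hs η 0 ?_
    rwa [map_zero, ← u.mul_right_eq_zero]
  have mul_mem : u * (w : Q) ∈ B := by
    rw [hw_eq, h.mul_inv_add]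
    exact B.add_mem B.one_mem (B.mul_mem (hι _) sq_mem)
  rw [← hw_eq] at hw
  simpa only [Units.mul_inv_cancel_right] using B.mul_mem mul_mem (units_inv_mem hw)

end Linear

variable [Finite L] (hu : ∀ c ∈ skewCode ι (u : Q) F.natDegree φ, c ≠ 0 → IsUnit c)
  (hB : ∀ c ∈ skewCode ι (u : Q) F.natDegree φ, ↑u⁻¹ * c ∈ B)
include hu hB

lemma var_mem_of_natDegree_eq_two (hs : F.natDegree = 2) (hφ : Function.Injective φ) :
    (u : Q) ∈ B := by
  by_contra hnot
  have hι := h.const_mem hS.one_lt hB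
  obtain ⟨η, hη⟩ := σ.surjective (φ 1)
  have hη0 : η ≠ 0 := by
    rintro rfl
    exact one_ne_zero (hφ (by rw [← hη, map_zero, map_zero]))
  have hw : ↑u⁻¹ + ι η * u ∈ B := by
    have mem := h.inv_add_mem hs hB (a := 1) (b := η) (by rw [map_one, hη])
    rwa [map_one, one_mul] at mem
  have eq_of_mul_mem {a b : L} (hab : ι (a - b) * u ∈ B) : a = b := by
    by_contra hne
    exact hnot (mem_of_const_mul_mem hι (sub_ne_zero.2 hne) hab)
  have map_eq_mul (c : L) : φ c = σ η * c := by
    rw [← σ.apply_symm_apply c, ← map_mul σ, ← σ.apply_symm_apply (φ _), σ.injective.eq_iff]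
    refine eq_of_mul_mem ?_
    convert B.sub_mem (h.inv_add_mem hs hB (σ.apply_symm_apply _).symm)
      (B.mul_mem (hι (σ.symm c)) hw) using 1
    rw [mul_add, add_sub_add_left_eq_sub, ← mul_assoc, ← map_mul, ← sub_mul, ← map_sub,
      mul_comm η]
  have hσ : σ ^ 2 = 1 := AlgEquiv.ext fun a => by
    rw [sq, AlgEquiv.mul_apply, AlgEquiv.one_apply]
    refine mul_left_cancel₀ hη0 (eq_of_mul_mem ?_)
    convert B.sub_mem (B.mul_mem hw (hι (σ a))) (B.mul_mem (hι a) hw) using 1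
    rw [mul_add, add_mul, h.inv_mul_apply, add_sub_add_left_eq_sub, mul_assoc, h.mul_apply,
      ← mul_assoc, ← mul_assoc, ← map_mul, ← map_mul, ← sub_mul, ← map_sub, mul_comm a]
  have hn : n = 2 := le_antisymm
    (Nat.le_of_dvd two_pos (hS.orderOf_eq ▸ orderOf_dvd_of_pow_eq_one hσ)) hS.two_le
  exact hnot (h.var_mem_of_linear hS map_eq_mul hu hn hs hη0 hι hw)

theorem eq_top_of_inv_var_mul_mem (hφ : φ = 0 ∨ Function.Injective φ) : B = ⊤ := by
  refine h.eq_top_of_mem (h.const_mem hS.one_lt hB) ?_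
  rcases hφ with rfl | hφ
  · have : Finite Q := h.finite hS.mul_natDegree_pos hS.monic
    have mem := hB _ (const_add_mem_skewCode hS.natDegree_pos 1)
    rw [AddMonoidHom.zero_apply, map_zero, zero_mul, add_zero, map_one, mul_one] at mem
    simpa only [inv_inv] using units_inv_mem mem
  obtain hs | hs : F.natDegree = 2 ∨ 2 < F.natDegree := by have := hS.one_lt; omega
  · exact h.var_mem_of_natDegree_eq_two hS hu hB hs hφ
  · have mem := hB _ (const_mul_pow_mem_skewCode two_pos hs 1)
    rwa [map_one, one_mul, sq, Units.inv_mul_cancel_left] at mem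

end IsSkewModel

end Generation

section StabilizingScalars

/-- The scalars `e` with `e C ⊆ C`, for an additive subgroup `C` of a module. -/
def stabilizingScalars (E : Type*) {M : Type*} [Semiring E] [AddCommGroup M] [Module E M]
    (C : AddSubgroup M) : Set E :=
  {e | ∀ c ∈ C, e • c ∈ C}

lemma algebraMap_mem_leftIdealizer {E Q : Type*} [CommRing E] [Ring Q] [Algebra E Q]
    {C : AddSubgroup Q} {e : E} :
    algebraMap E Q e ∈ leftIdealizer C ↔ e ∈ stabilizingScalars E C :=
  forall₂_congr fun c _ => by rw [Algebra.smul_def]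

end StabilizingScalars

section UnitTranslate

open Pointwise

variable {Q : Type*} [Ring Q] (u : Qˣ) (C : AddSubgroup Q)

lemma natCard_leftIdealizer_units_smul :
    Nat.card (leftIdealizer (u • C)) = Nat.card (leftIdealizer C) := by
  refine Nat.card_congr (((Units.mulLeft u⁻¹).trans (Units.mulRight u)).subtypeEquiv fun z => ?_)
  change (∀ c ∈ u • C, z * c ∈ u • C) ↔ ∀ c ∈ C, ↑u⁻¹ * z * u * c ∈ C
  simp only [AddSubgroup.mem_smul_pointwise_iff_exists, forall_exists_index, and_imp,
    forall_apply_eq_imp_iff₂, Units.smul_def, smul_eq_mul]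
  refine forall₂_congr fun c _ => ⟨?_, fun hc => ⟨_, hc, ?_⟩⟩
  · rintro ⟨d, hd, hdc⟩
    rwa [mul_assoc, mul_assoc, ← hdc, Units.inv_mul_cancel_left]
  · rw [mul_assoc, mul_assoc, Units.mul_inv_cancel_left]

lemma rightIdealizer_units_smul : rightIdealizer (u • C) = rightIdealizer C := by
  ext z
  change (∀ c ∈ u • C, c * z ∈ u • C) ↔ ∀ c ∈ C, c * z ∈ C
  simp only [AddSubgroup.mem_smul_pointwise_iff_exists, forall_exists_index, and_imp,
    forall_apply_eq_imp_iff₂, Units.smul_def, smul_eq_mul, mul_assoc, Units.mul_right_inj,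
    exists_eq_right]

lemma stabilizingScalars_units_smul {E : Type*} [CommRing E] [Algebra E Q] :
    stabilizingScalars E (u • C) = stabilizingScalars E C := by
  ext e
  change (∀ c ∈ u • C, e • c ∈ u • C) ↔ ∀ c ∈ C, e • c ∈ C
  simp only [AddSubgroup.mem_smul_pointwise_iff_exists, forall_exists_index, and_imp,
    forall_apply_eq_imp_iff₂, Units.smul_def, smul_eq_mul, ← mul_smul_comm, Units.mul_right_inj,
    exists_eq_right]

variable {u C} in
/- The ring generated by `w⁻¹ C` contains `u⁻¹ c = (w⁻¹ u)⁻¹ (w⁻¹ c)` for `c ∈ C`. -/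
lemma eq_top_of_inv_smul_le [Finite Q] {w : Qˣ} (huC : (u : Q) ∈ C)
    (hgen : ∀ B : Subring Q, u⁻¹ • C ≤ B.toAddSubgroup → B = ⊤) {B : Subring Q}
    (hB : w⁻¹ • C ≤ B.toAddSubgroup) : B = ⊤ := by
  refine hgen B ?_
  have mem {c : Q} (hc : c ∈ C) : ↑w⁻¹ * c ∈ B :=
    hB (AddSubgroup.smul_mem_pointwise_smul c w⁻¹ C hc)
  have inv_mem := units_inv_mem (u := w⁻¹ * u) (mem huC)
  rintro _ ⟨c, hc, rfl⟩
  convert B.mul_mem inv_mem (mem hc) using 1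
  rw [mul_inv_rev, inv_inv, Units.val_mul, mul_assoc, Units.mul_inv_cancel_left]
  rfl

end UnitTranslate

section LeftMulRep

variable {E m : Type*} [Field E] [Fintype m]

open Matrix

lemma exists_eq_smul_of_forall_mulVec (Y : (m → E) →+ (m → E))
    (hY : ∀ (M : Matrix m m E) w, Y (M *ᵥ w) = M *ᵥ Y w) : ∃ e : E, ∀ w, Y w = e • w := by
  rcases isEmpty_or_nonempty m with _ | ⟨⟨i⟩⟩
  · exact ⟨1, fun w => Subsingleton.elim _ _⟩
  classical
  refine ⟨Y (Pi.single i 1) i, fun w => ?_⟩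
  have h := hY (vecMulVec w (Pi.single i 1)) (Pi.single i 1)
  simp only [vecMulVec_mulVec, single_dotProduct, Pi.single_eq_same, one_mul,
    MulOpposite.op_one, one_smul] at h
  rw [h]
  ext j
  simp [mul_comm]

/-- `β` identifies `S` with `E ^ m` in such a way that left multiplication by `a` becomes the
matrix `μ a`. -/
def IsLeftMulRep {S : Type*} [NonAssocRing S] (μ : S →+ Matrix m m E) (β : S ≃+ (m → E)) : Prop :=
  ∀ a b, β (a * b) = μ a *ᵥ β b

namespace IsLeftMulRep

variable {S : Type*} [NonAssocRing S] {μ : S →+ Matrix m m E} {β : S ≃+ (m → E)}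
  (h : IsLeftMulRep μ β)

include h

lemma mulVec_map_one (a : S) : μ a *ᵥ β 1 = β a := by rw [← h, mul_one]

lemma injective : Function.Injective μ := fun a b hab =>
  β.injective (by rw [← h.mulVec_map_one, hab, h.mulVec_map_one])

omit h in
lemma matrix_ext {M N : Matrix m m E} (hMN : ∀ b : S, M *ᵥ β b = N *ᵥ β b) : M = N :=
  mulVec_injective (funext fun w => by simpa using hMN (β.symm w))

lemma map_one [DecidableEq m] : μ 1 = 1 := matrix_ext fun b => by rw [← h, one_mul, one_mulVec]

lemma mul_assoc_iff {a b : S} : (∀ c, a * (b * c) = a * b * c) ↔ μ a * μ b ∈ μ.range := by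
  constructor
  · intro hab
    exact ⟨a * b, matrix_ext fun c => by rw [← h, ← hab, h, h, mulVec_mulVec]⟩
  · rintro ⟨d, hd⟩ c
    have d_eq : d = a * b := β.injective (by
      rw [← h.mulVec_map_one, hd, ← mulVec_mulVec, h.mulVec_map_one, h])
    exact β.injective (by rw [h, h, mulVec_mulVec, ← hd, ← h, d_eq])

lemma natCard_leftNucleus [DecidableEq m] :
    Nat.card (leftNucleus S) = Nat.card (leftIdealizer μ.range) := by
  have preimage_eq : leftNucleus S = μ ⁻¹' leftIdealizer μ.range := by
    ext a
    exact (forall_congr' fun _ => h.mul_assoc_iff).trans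
      (Set.forall_mem_range (p := (μ a * · ∈ μ.range))).symm
  rw [preimage_eq, Nat.card_preimage_of_injective h.injective]
  · rfl
  · exact fun z hz => by simpa using hz 1 ⟨1, h.map_one⟩

lemma natCard_middleNucleus [DecidableEq m] :
    Nat.card (middleNucleus S) = Nat.card (rightIdealizer μ.range) := by
  have preimage_eq : middleNucleus S = μ ⁻¹' rightIdealizer μ.range := by
    ext b
    exact (forall_congr' fun _ => h.mul_assoc_iff).trans
      (Set.forall_mem_range (p := (· * μ b ∈ μ.range))).symm
  rw [preimage_eq, Nat.card_preimage_of_injective h.injective]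
  · rfl
  · exact fun z hz => by simpa using hz 1 ⟨1, h.map_one⟩

section Scalar

variable {c : S} {e : E} (hc : β c = e • β 1)
include hc

lemma map_mul_of_map_eq_smul (b : S) : β (b * c) = e • β b := by
  rw [h, hc, mulVec_smul, h.mulVec_map_one]

lemma mem_rightNucleus_of_map_eq_smul : c ∈ rightNucleus S := fun a b =>
  β.injective (by rw [h, h.map_mul_of_map_eq_smul hc, h.map_mul_of_map_eq_smul hc, mulVec_smul, h])

lemma smul_mem_range_iff {b : S} : e • μ b ∈ μ.range ↔ μ (b * c) = e • μ b := by
  refine ⟨?_, fun hb => ⟨_, hb⟩⟩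
  rintro ⟨d, hd⟩
  have d_eq : d = b * c := β.injective (by
    rw [← h.mulVec_map_one, hd, smul_mulVec, h.mulVec_map_one, h.map_mul_of_map_eq_smul hc])
  rw [← d_eq, hd]

lemma mem_centre_iff : c ∈ centre S ↔ e ∈ stabilizingScalars E μ.range := by
  have stabilizes_iff : e ∈ stabilizingScalars E μ.range ↔ ∀ b, μ (b * c) = e • μ b :=
    Set.forall_mem_range.trans (forall_congr' fun b => h.smul_mem_range_iff hc)
  rw [stabilizes_iff]
  constructor
  · rintro ⟨left, -, -, comm⟩ b
    refine matrix_ext (β := β) fun d => ?_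
    rw [smul_mulVec, ← h, ← h, ← comm, ← left, comm, h.map_mul_of_map_eq_smul hc]
  · intro hμ
    classical
    have μ_c : μ c = e • 1 := by simpa only [one_mul, h.map_one] using hμ 1
    have comm (b : S) : c * b = b * c := β.injective (by
      rw [h, μ_c, smul_mulVec, one_mulVec, h.map_mul_of_map_eq_smul hc])
    refine ⟨fun b => h.mul_assoc_iff.2 ⟨b * c, ?_⟩, fun a => h.mul_assoc_iff.2 ⟨a * c, ?_⟩,
      h.mem_rightNucleus_of_map_eq_smul hc, comm⟩
    · rw [hμ, μ_c, smul_mul_assoc, one_mul]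
    · rw [hμ, μ_c, mul_smul_comm, mul_one]

end Scalar

omit [Fintype m] h in
lemma smul_map_one_injective [Nontrivial S] : Function.Injective fun e : E => e • β 1 :=
  smul_left_injective E (by simp)

variable [DecidableEq m] (hgen : ∀ B : Subring (Matrix m m E), μ.range ≤ B.toAddSubgroup → B = ⊤)
include hgen

/- Right multiplication by an element of the right nucleus commutes with all left multiplications,
hence with the ring that they generate. -/
lemma exists_map_eq_smul {c : S} (hc : c ∈ rightNucleus S) : ∃ e : E, β c = e • β 1 := by
  let Y : (m → E) →+ (m → E) :=
    (β.toAddMonoidHom.comp (AddMonoidHom.mulRight c)).comp β.symm.toAddMonoidHom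
  have Y_β (b : S) : Y (β b) = β (b * c) := by simp [Y]
  let B : Subring (Matrix m m E) :=
    { carrier := {M | ∀ w, Y (M *ᵥ w) = M *ᵥ Y w}
      mul_mem' := fun hM hN w => by rw [← mulVec_mulVec, hM, hN, mulVec_mulVec]
      one_mem' := fun w => by rw [one_mulVec, one_mulVec]
      add_mem' := fun hM hN w => by rw [add_mulVec, map_add, hM, hN, add_mulVec]
      zero_mem' := fun w => by rw [zero_mulVec, map_zero, zero_mulVec]
      neg_mem' := fun hM w => by rw [neg_mulVec, map_neg, hM, neg_mulVec] }
  have B_eq_top : B = ⊤ := by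
    refine hgen B ?_
    rintro _ ⟨a, rfl⟩ w
    obtain ⟨b, rfl⟩ := β.surjective w
    rw [← h, Y_β, Y_β, ← hc, h]
  obtain ⟨e, he⟩ := exists_eq_smul_of_forall_mulVec Y fun M =>
    (B_eq_top ▸ Subring.mem_top M : M ∈ B)
  exact ⟨e, by rw [← he, Y_β, one_mul]⟩

variable [Nontrivial S]

lemma natCard_rightNucleus : Nat.card (rightNucleus S) = Nat.card E := by
  have image_eq : β '' rightNucleus S = Set.range fun e : E => e • β 1 := by
    ext w
    constructor
    · rintro ⟨c, hc, rfl⟩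
      obtain ⟨e, he⟩ := h.exists_map_eq_smul hgen hc
      exact ⟨e, he.symm⟩
    · rintro ⟨e, rfl⟩
      exact ⟨β.symm (e • β 1), h.mem_rightNucleus_of_map_eq_smul (β.apply_symm_apply _),
        β.apply_symm_apply _⟩
  rw [← Nat.card_image_of_injective β.injective, image_eq,
    Nat.card_range_of_injective smul_map_one_injective]

lemma natCard_centre : Nat.card (centre S) = Nat.card (stabilizingScalars E μ.range) := by
  have image_eq : β '' centre S = (fun e : E => e • β 1) '' stabilizingScalars E μ.range := by
    ext w
    constructor
    · rintro ⟨c, hc, rfl⟩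
      obtain ⟨e, he⟩ := h.exists_map_eq_smul hgen hc.2.2.1
      exact ⟨e, (h.mem_centre_iff he).1 hc, he.symm⟩
    · rintro ⟨e, he, rfl⟩
      exact ⟨β.symm (e • β 1), (h.mem_centre_iff (β.apply_symm_apply _)).2 he,
        β.apply_symm_apply _⟩
  rw [← Nat.card_image_of_injective β.injective, image_eq,
    Nat.card_image_of_injective smul_map_one_injective]

end IsLeftMulRep

end LeftMulRep

section NuclearParameters

open Matrix Pointwise

universe u

variable {E : Type u} [Field E] {n : ℕ} {C : AddSubgroup (Matrix (Fin n) (Fin n) E)}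
  {S : Type u} [NonAssocRing S]

lemma IsIsotopicTo.exists_isLeftMulRep (h : IsIsotopicTo S (C : Set (Matrix (Fin n) (Fin n) E))) :
    ∃ (w : (Matrix (Fin n) (Fin n) E)ˣ) (μ : S →+ Matrix (Fin n) (Fin n) E)
      (β : S ≃+ (Fin n → E)), IsLeftMulRep μ β ∧ μ.range = w⁻¹ • C := by
  obtain ⟨φ, -, hC, α, β, γ, hmul⟩ := h
  have isUnit_one : IsUnit (φ (α 1)) := by
    rw [← mulVec_surjective_iff_isUnit]
    exact fun w => ⟨β (γ.symm w), by rw [← hmul, one_mul, γ.apply_symm_apply]⟩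
  have range_eq : (φ.comp α.toAddMonoidHom).range = C :=
    SetLike.coe_injective ((α.surjective.range_comp φ).trans hC)
  obtain ⟨w, hw⟩ := isUnit_one
  refine ⟨w, (DistribSMul.toAddMonoidHom _ w⁻¹).comp (φ.comp α.toAddMonoidHom), β,
    fun a b => ?_, by rw [AddMonoidHom.range_comp, range_eq]; rfl⟩
  change _ = (_ * φ (α a)) *ᵥ β b
  rw [← mulVec_mulVec, ← hmul, ← one_mul (a * b), hmul, ← hw, mulVec_mulVec, w.inv_mul,
    one_mulVec, one_mul]

theorem nuclearParameters_eq [Finite E] (hS : IsSemifield S)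
    (hiso : IsIsotopicTo S (C : Set (Matrix (Fin n) (Fin n) E)))
    {u : (Matrix (Fin n) (Fin n) E)ˣ} (hu : (u : Matrix (Fin n) (Fin n) E) ∈ C)
    (hgen : ∀ B : Subring (Matrix (Fin n) (Fin n) E), u⁻¹ • C ≤ B.toAddSubgroup → B = ⊤) :
    nuclearParameters S = (Nat.card (Fin n → E), Nat.card (leftIdealizer C),
      Nat.card (rightIdealizer C), Nat.card E, Nat.card (stabilizingScalars E C)) := by
  obtain ⟨w, μ, β, h, hμ⟩ := hiso.exists_isLeftMulRep
  have := hS.1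
  have range_gen (B : Subring (Matrix (Fin n) (Fin n) E)) (hB : μ.range ≤ B.toAddSubgroup) :
      B = ⊤ := eq_top_of_inv_smul_le hu hgen (hμ ▸ hB)
  rw [nuclearParameters, Nat.card_congr β.toEquiv, h.natCard_leftNucleus,
    h.natCard_middleNucleus, h.natCard_rightNucleus range_gen, h.natCard_centre range_gen, hμ,
    natCard_leftIdealizer_units_smul, rightIdealizer_units_smul, stabilizingScalars_units_smul]

end NuclearParameters

section Existence

open Matrix

universe u

lemma exists_isSemifield_of_mul {A : Type u} [AddCommGroup A] [Finite A] (mul : A →+ A →+ A)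
    {e : A} (he : e ≠ 0) (one_mul : ∀ a, mul e a = a) (mul_one : ∀ a, mul a e = a)
    (mul_injective : ∀ a, a ≠ 0 → Function.Injective (mul a)) :
    ∃ (S : Type u) (_ : NonAssocRing S) (f : S ≃+ A),
      IsSemifield S ∧ ∀ a b, f (a * b) = mul (f a) (f b) := by
  let inst : NonAssocRing A :=
    { (inferInstance : AddCommGroup A) with
      mul := fun a b => mul a b
      one := e
      left_distrib := fun a => map_add (mul a)
      right_distrib := fun a b => DFunLike.congr_fun (map_add mul a b)
      zero_mul := DFunLike.congr_fun (map_zero mul)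
      mul_zero := fun a => map_zero (mul a)
      one_mul := one_mul
      mul_one := mul_one }
  refine ⟨A, inst, AddEquiv.refl A, ⟨⟨e, 0, he⟩, fun a ha => ⟨?_, ?_⟩⟩, fun a b => rfl⟩
  · exact Finite.injective_iff_bijective.1 (mul_injective a ha)
  · refine Finite.injective_iff_bijective.1 fun b c hbc => ?_
    by_contra hne
    refine ha (mul_injective _ (sub_ne_zero.2 hne) ?_)
    rw [map_sub, AddMonoidHom.sub_apply, map_zero]
    exact sub_eq_zero.2 hbc

variable {E : Type u} [Field E] {n : ℕ} [Finite E]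

namespace IsSpreadSet

variable {C : AddSubgroup (Matrix (Fin n) (Fin n) E)}
  (hC : IsSpreadSet (C : Set (Matrix (Fin n) (Fin n) E)))
include hC

lemma exists_section {v : Fin n → E} (hv : v ≠ 0) :
    ∃ φ : (Fin n → E) →+ Matrix (Fin n) (Fin n) E,
      (∀ a, φ a *ᵥ v = a) ∧ Set.range φ = (C : Set (Matrix (Fin n) (Fin n) E)) := by
  let ev : C →+ (Fin n → E) :=
    { toFun := fun X => X.1 *ᵥ v
      map_zero' := zero_mulVec v
      map_add' := fun X Y => add_mulVec X.1 Y.1 v }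
  have ev_injective : Function.Injective ev := by
    refine (injective_iff_map_eq_zero ev).2 fun X hX => ?_
    by_contra hne
    have isUnit_X := hC.isUnit X X.2 fun h0 => hne (Subtype.ext h0)
    exact hv (mulVec_injective_iff_isUnit.2 isUnit_X (hX.trans (mulVec_zero _).symm))
  let θ := AddEquiv.ofBijective ev
    ((Nat.bijective_iff_injective_and_card ev).2 ⟨ev_injective, hC.card_eq⟩)
  refine ⟨C.subtype.comp θ.symm.toAddMonoidHom, θ.apply_symm_apply, ?_⟩
  exact (θ.symm.surjective.range_comp C.subtype).trans Subtype.range_coe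

/- The product is `a * b = φ(a) φ(v)⁻¹ b`, where `φ(a) ∈ C` takes `v` to `a`, with identity `v`. -/
theorem exists_isSemifield [NeZero n] :
    ∃ (S : Type u) (_ : NonAssocRing S),
      IsSemifield S ∧ IsIsotopicTo S (C : Set (Matrix (Fin n) (Fin n) E)) := by
  obtain ⟨v, hv⟩ := exists_ne (0 : Fin n → E)
  obtain ⟨φ, φ_mulVec, range_φ⟩ := hC.exists_section hv
  have φ_injective : Function.Injective φ := fun a b hab => by
    rw [← φ_mulVec a, hab, φ_mulVec]
  have isUnit_φ {a : Fin n → E} (ha : a ≠ 0) : IsUnit (φ a) :=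
    hC.isUnit _ (range_φ ▸ ⟨a, rfl⟩) ((map_ne_zero_iff φ φ_injective).2 ha)
  obtain ⟨w, hw⟩ := isUnit_φ hv
  let w' : Matrix (Fin n) (Fin n) E := ↑w⁻¹
  have inv_mulVec : w' *ᵥ v = v := by
    conv_lhs => rw [← φ_mulVec v, ← hw, mulVec_mulVec, w.inv_mul, one_mulVec]
  let mul : (Fin n → E) →+ (Fin n → E) →+ (Fin n → E) :=
    AddMonoidHom.mk' (fun a => (mulVecLin (φ a * w')).toAddMonoidHom) fun a b => by
      ext; simp [add_mul]
  have mul_eq (a b : Fin n → E) : mul a b = (φ a * w') *ᵥ b := rfl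
  obtain ⟨S, _, f, hS, hf⟩ := exists_isSemifield_of_mul mul hv
    (fun a => by rw [mul_eq, ← hw, w.mul_inv, one_mulVec])
    (fun a => by rw [mul_eq, ← mulVec_mulVec, inv_mulVec, φ_mulVec])
    (fun a ha => mulVec_injective_iff_isUnit.2 ((isUnit_φ ha).mul w⁻¹.isUnit))
  let β := AddEquiv.ofBijective (mulVecLin w') ⟨mulVec_injective_iff_isUnit.2 w⁻¹.isUnit,
    mulVec_surjective_iff_isUnit.2 w⁻¹.isUnit⟩
  refine ⟨S, _, hS, φ, φ_injective, range_φ, f, f.trans β, f, fun a b => ?_⟩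
  rw [hf, mul_eq, ← mulVec_mulVec]
  rfl

end IsSpreadSet

end Existence

section Counting

variable {L : Type*} [Field L] [Finite L] {p N : ℕ} [Fact p.Prime] (hL : Nat.card L = p ^ N)
include hL

lemma natCard_pow_eq_self (u : ℕ) : Nat.card {a : L | a ^ p ^ u = a} = p ^ N.gcd u := by
  have p_pow_pos (m : ℕ) : 0 < p ^ m := pow_pos (Nat.Prime.pos Fact.out) m
  have set_eq : {a : L | a ^ p ^ u = a} =
      insert 0 (Units.val '' ((powMonoidHom (p ^ u - 1) : Lˣ →* Lˣ).ker : Set Lˣ)) := by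
    ext a
    rcases eq_or_ne a 0 with rfl | ha
    · simp [Nat.Prime.ne_zero (Fact.out : p.Prime)]
    · lift a to Lˣ using ha.isUnit
      simp only [Set.mem_ofPred_eq, Set.mem_insert_iff, ha, false_or,
        Units.val_injective.mem_set_image, SetLike.mem_coe, MonoidHom.mem_ker, powMonoidHom_apply]
      rw [← Units.val_pow_eq_pow_val, Units.val_inj]
      nth_rw 1 [← Nat.sub_add_cancel (p_pow_pos u)]
      rw [pow_succ, mul_eq_right]
  have zero_notMem :
      (0 : L) ∉ Units.val '' ((powMonoidHom (p ^ u - 1) : Lˣ →* Lˣ).ker : Set Lˣ) := by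
    rintro ⟨x, -, hx⟩
    exact x.ne_zero hx
  rw [Nat.card_coe_set_eq, set_eq, Set.ncard_insert_of_notMem zero_notMem,
    Set.ncard_image_of_injective _ Units.val_injective, ← Nat.card_coe_set_eq,
    SetLike.coe_sort_coe, IsCyclic.card_powMonoidHom_ker, Nat.card_units, hL,
    Nat.pow_sub_one_gcd_pow_sub_one, Nat.sub_add_cancel (p_pow_pos _)]

lemma pow_prime_pow_injective (v : ℕ) : Function.Injective fun a : L => a ^ p ^ v := by
  have := Fintype.ofFinite L
  have := charP_of_card_eq_prime_pow (Nat.card_eq_fintype_card (α := L) ▸ hL)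
  exact iterateFrobenius_inj L p v

lemma natCard_pow_eq_pow (u v : ℕ) :
    Nat.card {a : L | a ^ p ^ u = a ^ p ^ v} = p ^ Int.gcd N ((u : ℤ) - v) := by
  wlog hvu : v ≤ u generalizing u v
  · rw [← Int.neg_sub, Int.gcd_neg, ← this v u (le_of_not_ge hvu)]
    simp only [eq_comm]
  obtain ⟨d, rfl⟩ := Nat.exists_eq_add_of_le hvu
  have set_eq : {a : L | a ^ p ^ (v + d) = a ^ p ^ v} = {a : L | a ^ p ^ d = a} := by
    ext a
    rw [Set.mem_ofPred_eq, Set.mem_ofPred_eq, add_comm, pow_add, pow_mul]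
    exact (pow_prime_pow_injective hL v).eq_iff
  rw [set_eq, natCard_pow_eq_self hL, Nat.cast_add, add_sub_cancel_left, Int.gcd_natCast_natCast]

lemma natCard_pow_eq_self_and (u v : ℕ) :
    Nat.card {a : L | a ^ p ^ u = a ∧ a ^ p ^ v = a} = p ^ N.gcd (u.gcd v) := by
  have set_eq : {a : L | a ^ p ^ u = a ∧ a ^ p ^ v = a} = {a : L | a ^ p ^ u.gcd v = a} := by
    ext a
    have periodic_iff (k : ℕ) : a ^ p ^ k = a ↔ Function.IsPeriodicPt (fun x : L => x ^ p) k a := by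
      rw [Function.IsPeriodicPt, Function.IsFixedPt, pow_iterate]
    simp only [Set.mem_ofPred_eq, periodic_iff]
    exact ⟨fun h => h.1.gcd h.2,
      fun h => ⟨h.trans_dvd (Nat.gcd_dvd_left u v), h.trans_dvd (Nat.gcd_dvd_right u v)⟩⟩
  rw [set_eq, natCard_pow_eq_self hL]

end Counting

lemma natCard_adjoinRoot {K : Type*} [Field K] {F : K[X]} (hF : F ≠ 0) :
    Nat.card (AdjoinRoot F) = Nat.card K ^ F.natDegree := by
  have := (AdjoinRoot.powerBasis hF).finite
  rw [Module.natCard_eq_pow_finrank (K := K), (AdjoinRoot.powerBasis hF).finrank,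
    AdjoinRoot.powerBasis_dim]

section Parameters

universe u

variable {K L : Type*} [Field K] [Field L] [Algebra K L] [Finite L] {σ : L ≃ₐ[K] L} {n : ℕ}
  {F : K[X]}

lemma IsCyclicSetting.natCard_fixed (hS : IsCyclicSetting σ n F) :
    Nat.card {a | σ a = a} = Nat.card K := by
  have set_eq : {a | σ a = a} = Set.range (algebraMap K L) := by
    ext a
    exact ⟨hS.mem_range_algebraMap, by rintro ⟨c, rfl⟩; exact σ.commutes c⟩
  rw [set_eq, Nat.card_range_of_injective (algebraMap K L).injective]

namespace IsSkewModel

/- A constant is a scalar if and only if it is central, that is, if and only if it commutes with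
`x`. -/
lemma natCard_stabilizingScalars {Q : Type*} [Ring Q] {ι : L →+* Q} {t : Q} {C : AddSubgroup Q}
    {E : Type*} [Field E] [Algebra E Q] [Algebra.IsCentral E Q] {A : Set L}
    (h : IsSkewModel σ n F ι t) (hS : IsCyclicSetting σ n F)
    (hC : (leftIdealizer C : Set Q) = ι '' A) :
    Nat.card (stabilizingScalars E C) = Nat.card {a | a ∈ A ∧ σ a = a} := by
  have := h.nontrivial hS.mul_natDegree_pos
  have ι_injective := h.injective hS.mul_natDegree_pos
  have image_eq : algebraMap E Q '' stabilizingScalars E C = ι '' {a | a ∈ A ∧ σ a = a} := by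
    ext q
    constructor
    · rintro ⟨e, he, rfl⟩
      rw [← algebraMap_mem_leftIdealizer (Q := Q), ← SetLike.mem_coe, hC] at he
      obtain ⟨a, ha, hae⟩ := he
      refine ⟨a, ⟨ha, ι_injective ((h.isUnit_var hS).mul_right_cancel ?_)⟩, hae⟩
      rw [← h.mul_apply, hae, Algebra.commutes]
    · rintro ⟨a, ⟨ha, hσa⟩, rfl⟩
      have commute (q : Q) : Commute (ι a) q := h.commute_of_forall
        (fun b => (Commute.all a b).map ι) (by rw [commute_iff_eq, h.mul_apply, hσa]) q
      obtain ⟨e, he⟩ := (Algebra.IsCentral.mem_center_iff E).1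
        (Subalgebra.mem_center_iff.2 fun q => (commute q).symm.eq)
      refine ⟨e, ?_, he.symm⟩
      rw [← algebraMap_mem_leftIdealizer (Q := Q), ← SetLike.mem_coe, hC]
      exact ⟨a, ha, he⟩
  rw [← Nat.card_image_of_injective (algebraMap E Q).injective, image_eq,
    Nat.card_image_of_injective ι_injective]

variable {E : Type u} [Field E] [Finite E] {ι : L →+* Matrix (Fin n) (Fin n) E}
  {t : Matrix (Fin n) (Fin n) E} {φ : L →+ L} (h : IsSkewModel σ n F ι t)
  (hS : IsCodeSetting σ n F)
include h hS

theorem hasNuclearParameters_skewCode (hφ : φ = 0 ∨ Function.Injective φ)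
    (hC : IsSpreadSet (skewCode ι t F.natDegree φ : Set (Matrix (Fin n) (Fin n) E))) :
    HasNuclearParameters (skewCode ι t F.natDegree φ : Set (Matrix (Fin n) (Fin n) E))
      (Nat.card (Fin n → E), Nat.card {a | ∀ b, φ (a * b) = a * φ b},
        Nat.card {a | ∀ b, φ (a * b) = (σ ^ F.natDegree) a * φ b}, Nat.card E,
        Nat.card {a | (∀ b, φ (a * b) = a * φ b) ∧ σ a = a}) := by
  have : NeZero n := ⟨hS.pos.ne'⟩
  refine ⟨hC.exists_isSemifield, fun S _ hS_semifield hiso => ?_⟩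
  obtain ⟨u, rfl⟩ := h.isUnit_var hS.toIsCyclicSetting
  have ι_injective := h.injective hS.mul_natDegree_pos
  have left_eq := h.coe_leftIdealizer_skewCode hS hC.isUnit hφ
  have right_eq := h.coe_rightIdealizer_skewCode hS hC.isUnit hφ
  rw [nuclearParameters_eq hS_semifield hiso (var_mem_skewCode hS.one_lt) fun B hB =>
      h.eq_top_of_inv_var_mul_mem hS hC.isUnit
        (fun c hc => hB (AddSubgroup.smul_mem_pointwise_smul c u⁻¹ _ hc)) hφ,
    h.natCard_stabilizingScalars hS.toIsCyclicSetting left_eq, ← SetLike.coe_sort_coe, left_eq,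
    ← SetLike.coe_sort_coe, right_eq, Nat.card_image_of_injective ι_injective,
    Nat.card_image_of_injective ι_injective]
  rfl

end IsSkewModel

end Parameters

section PrimePowers

universe u

variable {K L : Type*} [Field K] [Field L] [Algebra K L] {σ : L ≃ₐ[K] L} {n : ℕ} {F : K[X]}

lemma algEquiv_pow_apply_eq_pow {q : ℕ} (hσ : ∀ x, σ x = x ^ q) (k : ℕ) (a : L) :
    (σ ^ k) a = a ^ q ^ k := by
  induction k generalizing a with
  | zero => simp
  | succ k ih => rw [pow_succ, AlgEquiv.mul_apply, ih, hσ, ← pow_mul, ← pow_succ']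

variable [Finite L]

lemma IsSkewModel.nonempty_ringEquiv_matrix {Q : Type*} [Ring Q] {ι : L →+* Q} {t : Q}
    (h : IsSkewModel σ n F ι t) (hS : IsCyclicSetting σ n F) {E : Type*} [Field E] [Finite E]
    (hE : Nat.card E = Nat.card K ^ F.natDegree) :
    Nonempty (Q ≃+* Matrix (Fin n) (Fin n) E) := by
  have := h.finite hS.mul_natDegree_pos hS.monic
  have := h.isSimpleRing hS
  refine SkewSemifield.nonempty_ringEquiv_matrix (by rw [h.natCard_center hS, hE]) ?_
  rw [h.natCard_eq hS.mul_natDegree_pos hS.monic, hS.natCard_eq_pow, hE, ← pow_mul, ← pow_mul]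
  ring_nf

variable {p e j : ℕ} (hK : Nat.card K = p ^ e)
include hK

namespace IsCyclicSetting

variable (hS : IsCyclicSetting σ n F)
include hS

lemma natCard_eq_prime_pow : Nat.card L = p ^ (n * e) := by
  rw [hS.natCard_eq_pow, hK, ← pow_mul, mul_comm]

lemma gcd_mul_eq [Fact p.Prime] (hσ : ∀ x, σ x = x ^ p ^ j) : Nat.gcd (n * e) j = e := by
  have natCard_fixed := hS.natCard_fixed
  simp only [hσ] at natCard_fixed
  rw [natCard_pow_eq_self (hS.natCard_eq_prime_pow hK), hK] at natCard_fixed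
  exact Nat.pow_right_injective (Nat.Prime.two_le Fact.out) natCard_fixed

end IsCyclicSetting

namespace IsSkewModel

variable {E : Type u} [Field E] {ι : L →+* Matrix (Fin n) (Fin n) E}
  {t : Matrix (Fin n) (Fin n) E} (h : IsSkewModel σ n F ι t) (hS : IsCodeSetting σ n F)
  (hE : Nat.card E = Nat.card K ^ F.natDegree)
include h hS hE

variable [Finite E] in
theorem hasNuclearParameters_skewCode_zero :
    HasNuclearParameters (skewCode ι t F.natDegree 0 : Set (Matrix (Fin n) (Fin n) E))
      (p ^ (n * F.natDegree * e), p ^ (n * e), p ^ (n * e), p ^ (F.natDegree * e), p ^ e) := by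
  convert h.hasNuclearParameters_skewCode hS (Or.inl rfl) (isSpreadSet_skewCode_zero hS h hE)
    using 2
  · rw [Nat.card_fun, Nat.card_fin, hE, hK]
    ring
  · simp [hS.natCard_eq_prime_pow hK, hS.natCard_fixed, hK, hE, ← pow_mul, mul_comm e]

theorem hasNuclearParameters_skewCode_of_ne_zero [Finite E] [Fact p.Prime]
    (hσ : ∀ x, σ x = x ^ p ^ j) {i : ℕ} {φ : L →+ L} {η : L} (hη : η ≠ 0)
    (hφ : ∀ a, φ a = η * a ^ p ^ i)
    (hC : IsSpreadSet (skewCode ι t F.natDegree φ : Set (Matrix (Fin n) (Fin n) E))) :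
    HasNuclearParameters (skewCode ι t F.natDegree φ : Set (Matrix (Fin n) (Fin n) E))
      (p ^ (n * F.natDegree * e), p ^ Nat.gcd (n * e) i,
        p ^ Int.gcd (n * e) (F.natDegree * j - i), p ^ (F.natDegree * Nat.gcd (n * e) j),
        p ^ Nat.gcd (n * e) (Nat.gcd i j)) := by
  have hL := hS.natCard_eq_prime_pow hK
  have φ_injective : Function.Injective φ := fun a b hab => by
    rw [hφ, hφ] at hab
    exact pow_prime_pow_injective hL i (mul_left_cancel₀ hη hab)
  have map_mul_iff (a c : L) : (∀ b, φ (a * b) = c * φ b) ↔ a ^ p ^ i = c := by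
    simp only [hφ, mul_pow, mul_left_comm c]
    refine ⟨fun hac => ?_, fun hac b => by rw [hac]⟩
    simpa [hη] using hac 1
  convert h.hasNuclearParameters_skewCode hS (Or.inr φ_injective) hC using 2
  · rw [Nat.card_fun, Nat.card_fin, hE, hK]
    ring
  · simp only [map_mul_iff, algEquiv_pow_apply_eq_pow hσ, hσ, ← pow_mul p j]
    rw [natCard_pow_eq_self hL, natCard_pow_eq_pow hL, natCard_pow_eq_self_and hL, hE, hK,
      hS.gcd_mul_eq hK hσ, ← pow_mul, mul_comm e, ← Int.neg_sub, Int.gcd_neg, mul_comm j]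
    push_cast
    rfl

end IsSkewModel

end PrimePowers

end SkewSemifield

theorem mainTheorem4 {K L : Type*} [Field K] [Finite K] [Field L] [Algebra K L]
    (p n e i j s : ℕ) [Fact p.Prime]
    (hK : Nat.card K = p ^ e) (hL : Module.finrank K L = n) (hn : 2 ≤ n) (hs : 1 < s)
    (σ : L ≃ₐ[K] L) (hσgen : ∀ τ : L ≃ₐ[K] L, τ ∈ Subgroup.zpowers σ)
    (hσ : ∀ x : L, σ x = x ^ p ^ j)
    (ρ : L ≃+* L) (hρ : ∀ x : L, ρ x = x ^ p ^ i)
    (F : Polynomial K) (hFmonic : F.Monic) (hFirr : Irreducible F) (hFdeg : F.natDegree = s) :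
    Nonempty (SkewSemifield.QuotRing σ n F ≃+* Matrix (Fin n) (Fin n) (AdjoinRoot F)) ∧
    ∀ Φ : SkewSemifield.QuotRing σ n F ≃+* Matrix (Fin n) (Fin n) (AdjoinRoot F),
      -- the norm condition gives semifields
      (∀ (η : L) (K' : Subfield K),
        (∀ c ∈ K', ρ (algebraMap K L c) = algebraMap K L c) →
        Algebra.norm K' η * Algebra.norm K' ((-1) ^ (s * (n - 1)) * F.coeff 0) ≠ 1 →
        SkewSemifield.IsSpreadSet (Φ '' SkewSemifield.code σ n 1 η ρ F)) ∧
      -- the case of nonzero `η`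
      (∀ η : L, η ≠ 0 →
        SkewSemifield.IsSpreadSet (Φ '' SkewSemifield.code σ n 1 η ρ F) →
        SkewSemifield.HasNuclearParameters (Φ '' SkewSemifield.code σ n 1 η ρ F)
          (p ^ (n * s * e),
            p ^ Nat.gcd (n * e) i,
            p ^ Int.gcd (n * e) (s * j - i),
            p ^ (s * Nat.gcd (n * e) j),
            p ^ Nat.gcd (n * e) (Nat.gcd i j))) ∧
      -- the case `η = 0`
      SkewSemifield.IsSpreadSet (Φ '' SkewSemifield.code σ n 1 0 (fun _ => 0) F) ∧
      SkewSemifield.HasNuclearParameters (Φ '' SkewSemifield.code σ n 1 0 (fun _ => 0) F)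
        (p ^ (n * s * e), p ^ (n * e), p ^ (n * e), p ^ (s * e), p ^ e) := by
  subst hFdeg
  have : FiniteDimensional K L := FiniteDimensional.of_finrank_pos (by omega)
  have : Finite L := Module.finite_of_finite K
  have : Fact (Irreducible F) := ⟨hFirr⟩
  have : Module.Finite K (AdjoinRoot F) := hFmonic.finite_adjoinRoot
  have : Finite (AdjoinRoot F) := Module.finite_of_finite K
  have hE := SkewSemifield.natCard_adjoinRoot hFirr.ne_zero
  have hS : SkewSemifield.IsCodeSetting σ n F :=
    ⟨⟨hσgen, hL, hFmonic, hFirr,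
      SkewSemifield.coeff_zero_ne_zero_of_irreducible hFirr hs⟩, hn, hs⟩
  have h := SkewSemifield.isSkewModel_quotRing hS.pow_eq_one F
  refine ⟨h.nonempty_ringEquiv_matrix hS.toIsCyclicSetting hE, fun Φ => ?_⟩
  let φ (η : L) : L →+ L := (AddMonoidHom.mulLeft η).comp (ρ : L →+ L)
  have image_code (η : L) := SkewSemifield.image_code (φ := φ η) (η := η) (ρ := ρ)
    (fun _ => rfl) Φ
  rw [SkewSemifield.image_code (φ := 0) (by simp) Φ]
  refine ⟨fun η K' hK' hη => ?_, fun η hη hC => ?_,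
    SkewSemifield.isSpreadSet_skewCode_zero hS (h.map Φ) hE,
    (h.map Φ).hasNuclearParameters_skewCode_zero hK hS hE⟩
  · exact image_code η ▸ SkewSemifield.isSpreadSet_skewCode_of_norm_ne_one hS (h.map Φ) hE K' hK'
      (fun _ => rfl) hη
  · rw [image_code] at hC ⊢
    exact (h.map Φ).hasNuclearParameters_skewCode_of_ne_zero hK hS hE hσ hη
      (fun a => congrArg (η * ·) (hρ a)) hC
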